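/- For functions $f:(0,\infty)\to\mathbb C$ and $y>0$ let $$\mathscr P\{f(x);y\}=\int_0^\infty\frac{x f(x)}{x^2+y^2}\,dx,\qquad \mathscr K_\nu\{f(x);y\}=\int_0^\infty\sqrt{xy}\,K_\nu(xy)f(x)\,dx,\qquad \mathscr L\{f(x);y\}=\int_0^\infty e^{-xy}f(x)\,dx$$ be the Widder potential transform, the $\mathscr K_\nu$-transform ($K_\nu$ being the modified Bessel function of the second kind, or Macdonald function, of order $\nu\in\mathbb C$), and the Laplace transform. Let $g:(0,\infty)\to\mathbb C$ and $t>0$. (1) If $-1<\operatorname{Re}\nu<3/2$, then $$\mathscr P\big\{x^{2\nu}\,\mathscr P\{u^{-\nu-1/2}g(u);x\};t\big\}=t^{\nu-1/2}\,\mathscr K_\nu\big\{\mathscr K_\nu\{g(u);y\};t\big\}.$$ (2) $$\mathscr P\big\{x\,\mathscr P\{u^{-1}g(u);x\};t\big\}=\frac{\pi}{2}\,\mathscr L\big\{\mathscr L\{g(u);y\};t\big\}.$$ (3) $$\mathscr P\big\{x^{-1}\,\mathscr P\{g(u);x\};t\big\}=\frac{\pi}{2}\,t^{-1}\,\mathscr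 L\big\{\mathscr L\{g(u);y\};t\big\}.$$ Each of these identities holds provided that both of its members exist, that is: each inner transform exists as a Lebesgue (absolutely convergent) integral at every point of $(0,\infty)$, and each outer transform exists as a Lebesgue integral at $t$. -/

import Mathlib

open MeasureTheory Set

noncomputable section

/-- The modified Bessel function of the second kind (Macdonald function) `K_ν(x)` of complex
order `ν`, at a real argument `x > 0`:
`K_ν(x) = ∫_0^∞ exp(-x cosh s) cosh(ν s) ds`. -/
def macdonaldK (ν : ℂ) (x : ℝ) : ℂ :=
  ∫ s in Ioi (0 : ℝ), (Real.exp (-x * Real.cosh s) : ℂ) * Complex.cosh (ν * s)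

/-- The integrand `x f(x) / (x² + y²)` of the Widder potential transform. -/
def widderIntegrand (f : ℝ → ℂ) (y x : ℝ) : ℂ :=
  (x : ℂ) * f x / ((x : ℂ) ^ 2 + (y : ℂ) ^ 2)

/-- The Widder potential transform `𝒫{f(x); y} = ∫_0^∞ x f(x) / (x² + y²) dx`. -/
def widderTransform (f : ℝ → ℂ) (y : ℝ) : ℂ :=
  ∫ x in Ioi (0 : ℝ), widderIntegrand f y x

/-- The integral defining `𝒫{f(x); y}` exists (as a Lebesgue integral). -/
def WidderExists (f : ℝ → ℂ) (y : ℝ) : Prop :=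
  IntegrableOn (widderIntegrand f y) (Ioi 0)

/-- The integrand `√(xy) K_ν(xy) f(x)` of the `𝒦_ν`-transform. -/
def macdonaldIntegrand (ν : ℂ) (f : ℝ → ℂ) (y x : ℝ) : ℂ :=
  (Real.sqrt (x * y) : ℂ) * macdonaldK ν (x * y) * f x

/-- The `𝒦_ν`-transform `𝒦_ν{f(x); y} = ∫_0^∞ √(xy) K_ν(xy) f(x) dx`. -/
def macdonaldTransform (ν : ℂ) (f : ℝ → ℂ) (y : ℝ) : ℂ :=
  ∫ x in Ioi (0 : ℝ), macdonaldIntegrand ν f y x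

/-- The integral defining `𝒦_ν{f(x); y}` exists (as a Lebesgue integral). -/
def MacdonaldExists (ν : ℂ) (f : ℝ → ℂ) (y : ℝ) : Prop :=
  IntegrableOn (macdonaldIntegrand ν f y) (Ioi 0)

/-- The integrand `exp(-xy) f(x)` of the Laplace transform. -/
def laplaceIntegrand (f : ℝ → ℂ) (y x : ℝ) : ℂ :=
  (Real.exp (-(x * y)) : ℂ) * f x

/-- The Laplace transform `ℒ{f(x); y} = ∫_0^∞ exp(-xy) f(x) dx`. -/
def laplaceTransform (f : ℝ → ℂ) (y : ℝ) : ℂ :=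
  ∫ x in Ioi (0 : ℝ), laplaceIntegrand f y x

/-- The integral defining `ℒ{f(x); y}` exists (as a Lebesgue integral). -/
def LaplaceExists (f : ℝ → ℂ) (y : ℝ) : Prop :=
  IntegrableOn (laplaceIntegrand f y) (Ioi 0)

end

/-!
Write `h(u) = u ^ (1/2 - ν) g(u)` and `σ = Re ν`. Formally, both sides of the `𝒦_ν` identity are
`∫ h(u) k(u) du` with the same kernel `k`, because of the two representations

* `1 / (x² + u²) = ∫ e ^ (-q (x² + u²)) dq`,
* `u ^ ν K_ν(u y) = 1/2 (y/2) ^ ν ∫ q ^ (-ν - 1) e ^ (-u² q - y² / (4q)) dq`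
  (`cpow_mul_macdonaldK`).

Inserting them for `t` (with variable `p`) and for `u` (with variable `q`), the integrals over `x`
on one side and over `y` on the other are Gaussian moments, and both equal
`1/2 Γ(ν + 1) (p + q) ^ (-ν - 1) e ^ (-p t² - q u²)`. Only `-1 < σ` matters for this.

The function `h` is complex valued and the double integrals need not converge absolutely, so the
interchange of integrals has to be justified from the existence of the iterated ones. Restricting
`p` to `p > ε` inserts `e ^ (-ε (x² + t²))` on the Widder side and truncates the integral for
`K_ν(t y)` on the other. Then everything converges absolutely (`integrable_heatDensity`,
`integral_regularized_eq`), and `ε → 0` remains to be taken.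

* If `σ ≠ 0` or `ν = 0`, the modulus of `K_ν` is comparable with `K_σ` near the origin. For
  `ν = 0` this is trivial, for `σ < 0` it holds because `z ^ (-ν) K_ν(z)` tends at the origin to
  `2 ^ (-ν - 1) Γ(-ν)`, which is not zero, and for `σ > 0` because `K_{-ν} = K_ν`
  (`exists_heatIntegralR_le`). So the existence of the `𝒦_ν`-transforms implies absolute convergence
  with `K_σ`, which dominates the truncated kernels, and dominated convergence applies on both sides
  (`integral_eq_of_re_ne_zero`).
* If `ν` is purely imaginary and nonzero, `K_ν` has zeros accumulating at the origin and this
  comparison fails. But there oscillation helps: integration by parts gives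
  `|K_ν(z)| ≤ e ^ (-z) / |ν|` (`norm_macdonaldK_le_exp`), so that Fubini's theorem applies directly
  to the iterated `𝒦_ν`-transform, and likewise the kernels of the Widder side, truncated to a
  compact interval in `x`, are bounded by a multiple of `1 / (1 + u²)` uniformly in the truncation
  (`norm_integral_widderFactor_le`). The two kernels agree by `integral_regularized_eq` for a point
  mass at `u` and `ε = 0` (`integral_kernel_eq`).

The Laplace transform identities are the cases `ν = ±1/2`, because
`K_{1/2}(z) = √(π / (2z)) e ^ (-z)` (`macdonaldK_half`).
-/

noncomputable section

/-! ### The exponential representation of the Macdonald function -/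

/-- The integrand `p ^ (-ν - 1) exp (-u² p - y² / (4 p))`; its integral over `p > 0` is a multiple
of `u ^ ν K_ν(u y)`, see `cpow_mul_macdonaldK`. -/
def heatKernel (ν : ℂ) (y u p : ℝ) : ℂ :=
  (p : ℂ) ^ (-ν - 1) * (Real.exp (-(u ^ 2 * p) - y ^ 2 / (4 * p)) : ℂ)

/-- The real-valued version of `heatKernel`, for a real order; with `σ = Re ν` it is the absolute
value of `heatKernel` at `p > 0`. -/
def heatKernelR (σ y u p : ℝ) : ℝ :=
  p ^ (-σ - 1) * Real.exp (-(u ^ 2 * p) - y ^ 2 / (4 * p))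

/-- The integral of `heatKernel` over `p > ε`. Positive values of `ε` regularise the Parseval-type
identity `integral_regularized_eq`. -/
def heatIntegral (ε : ℝ) (ν : ℂ) (y u : ℝ) : ℂ :=
  ∫ p in Ioi ε, heatKernel ν y u p

/-- The integral of `heatKernelR` over `p > 0`. -/
def heatIntegralR (σ y u : ℝ) : ℝ :=
  ∫ p in Ioi (0 : ℝ), heatKernelR σ y u p

/-- The weight `y ((y / 2) ^ ν / 2)²` in the double integral over two copies of `heatKernel`. -/
def parsevalWeight (ν : ℂ) (y : ℝ) : ℂ :=
  (y : ℂ) * (1 / 2 * ((y / 2 : ℝ) : ℂ) ^ ν) ^ 2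

lemma heatKernelR_nonneg (σ y u : ℝ) {p : ℝ} (hp : 0 < p) : 0 ≤ heatKernelR σ y u p := by
  unfold heatKernelR; positivity

lemma norm_heatKernel (ν : ℂ) (y u : ℝ) {p : ℝ} (hp : 0 < p) :
    ‖heatKernel ν y u p‖ = heatKernelR ν.re y u p := by
  unfold heatKernel heatKernelR
  rw [norm_mul, Complex.norm_cpow_eq_rpow_re_of_pos hp, Complex.norm_real, Real.norm_eq_abs,
    abs_of_pos (Real.exp_pos _)]
  simp

lemma heatKernel_ofReal (σ y u : ℝ) {p : ℝ} (hp : 0 < p) :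
    heatKernel σ y u p = (heatKernelR σ y u p : ℝ) := by
  unfold heatKernel heatKernelR
  rw [Complex.ofReal_mul, Complex.ofReal_cpow hp.le]
  simp

@[fun_prop]
lemma measurable_heatKernel {α : Type*} [MeasurableSpace α] (ν : ℂ) {a b c : α → ℝ}
    (ha : Measurable a) (hb : Measurable b) (hc : Measurable c) :
    Measurable fun s => heatKernel ν (a s) (b s) (c s) := by
  unfold heatKernel; fun_prop

lemma measurable_heatKernelR (σ y u : ℝ) : Measurable (heatKernelR σ y u) := by
  unfold heatKernelR; fun_prop

lemma integrableOn_heatKernelR (σ : ℝ) {y u : ℝ} (hy : 0 < y) (hu : 0 < u) :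
    IntegrableOn (heatKernelR σ y u) (Ioi 0) := by
  obtain ⟨n, hn⟩ := exists_nat_gt σ
  have hI := integrableOn_rpow_mul_exp_neg_mul_rpow (p := 1) (s := n - σ - 1) (b := u ^ 2)
    (by linarith) one_pos (by positivity)
  refine (hI.const_mul ((n.factorial : ℝ) * (4 / y ^ 2) ^ n)).mono'
    (measurable_heatKernelR σ y u).aestronglyMeasurable ?_
  filter_upwards [ae_restrict_mem measurableSet_Ioi] with p hp
  have hp : 0 < p := hp
  rw [Real.norm_of_nonneg (heatKernelR_nonneg _ _ _ hp)]
  -- The factor `exp (-y² / (4p))` beats every power of `p` at the origin.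
  have h1 : Real.exp (-(y ^ 2 / (4 * p))) ≤ (n.factorial : ℝ) * (4 / y ^ 2) ^ n * p ^ n := by
    have h2 := Real.pow_div_factorial_le_exp (y ^ 2 / (4 * p)) (by positivity) n
    rw [Real.exp_neg, inv_le_comm₀ (Real.exp_pos _) (by positivity)]
    refine le_trans (le_of_eq ?_) h2
    rw [show y ^ 2 / (4 * p) = (4 / y ^ 2 * p)⁻¹ by field_simp, inv_pow, mul_pow,
      div_eq_mul_inv _ (n.factorial : ℝ), ← mul_inv]
    ring
  unfold heatKernelR
  rw [sub_eq_add_neg (-(u ^ 2 * p)), Real.exp_add, Real.rpow_one]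
  calc p ^ (-σ - 1) * (Real.exp (-(u ^ 2 * p)) * Real.exp (-(y ^ 2 / (4 * p))))
      ≤ p ^ (-σ - 1) * (Real.exp (-(u ^ 2 * p)) *
          ((n.factorial : ℝ) * (4 / y ^ 2) ^ n * p ^ n)) := by gcongr
    _ = _ := by
      rw [show (n : ℝ) - σ - 1 = (-σ - 1) + n by ring, Real.rpow_add hp, Real.rpow_natCast]
      ring_nf

lemma integrableOn_heatKernel (ν : ℂ) {y u : ℝ} (hy : 0 < y) (hu : 0 < u) :
    IntegrableOn (heatKernel ν y u) (Ioi 0) := by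
  refine (integrableOn_heatKernelR ν.re hy hu).mono' (by fun_prop) ?_
  filter_upwards [ae_restrict_mem measurableSet_Ioi] with p hp
  exact (norm_heatKernel ν y u hp).le

lemma heatIntegralR_nonneg (σ y u : ℝ) : 0 ≤ heatIntegralR σ y u :=
  setIntegral_nonneg measurableSet_Ioi fun _ hp => heatKernelR_nonneg _ _ _ hp

lemma norm_heatIntegral_le {ε : ℝ} (hε : 0 ≤ ε) (ν : ℂ) {y u : ℝ} (hy : 0 < y) (hu : 0 < u) :
    ‖heatIntegral ε ν y u‖ ≤ heatIntegralR ν.re y u := by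
  have hsub : Ioi ε ⊆ Ioi (0 : ℝ) := Ioi_subset_Ioi hε
  calc ‖heatIntegral ε ν y u‖ ≤ ∫ p in Ioi ε, heatKernelR ν.re y u p := by
        refine norm_integral_le_of_norm_le ((integrableOn_heatKernelR ν.re hy hu).mono_set hsub) ?_
        filter_upwards [ae_restrict_mem measurableSet_Ioi] with p hp
        exact (norm_heatKernel ν y u (hsub hp)).le
    _ ≤ _ := by
        refine setIntegral_mono_set (integrableOn_heatKernelR ν.re hy hu) ?_ hsub.eventuallyLE
        filter_upwards [ae_restrict_mem measurableSet_Ioi] with p hp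
        exact heatKernelR_nonneg _ _ _ hp

lemma heatIntegral_ofReal (σ y u : ℝ) : heatIntegral 0 σ y u = (heatIntegralR σ y u : ℝ) := by
  unfold heatIntegral heatIntegralR
  rw [← integral_complex_ofReal]
  exact setIntegral_congr_fun measurableSet_Ioi fun p hp => heatKernel_ofReal _ _ _ hp

lemma stronglyMeasurable_heatIntegral {α : Type*} [MeasurableSpace α] (ε : ℝ) (ν : ℂ)
    {a b : α → ℝ} (ha : Measurable a) (hb : Measurable b) :
    StronglyMeasurable fun s => heatIntegral ε ν (a s) (b s) := by
  unfold heatIntegral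
  refine StronglyMeasurable.integral_prod_right
    (f := fun s p => heatKernel ν (a s) (b s) p) ?_
  refine Measurable.stronglyMeasurable ?_
  unfold Function.uncurry
  fun_prop

lemma stronglyMeasurable_heatIntegralR {α : Type*} [MeasurableSpace α] (σ : ℝ)
    {a b : α → ℝ} (ha : Measurable a) (hb : Measurable b) :
    StronglyMeasurable fun s => heatIntegralR σ (a s) (b s) := by
  have h := (stronglyMeasurable_heatIntegral 0 σ ha hb).norm
  simpa only [heatIntegral_ofReal, Complex.norm_real,
    Real.norm_of_nonneg (heatIntegralR_nonneg _ _ _)] using h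

/-! ### Gaussian moments -/

lemma norm_cpow_two_mul {x : ℝ} (hx : 0 < x) (ν : ℂ) :
    ‖(x : ℂ) * (x : ℂ) ^ (2 * ν)‖ = x ^ (2 * ν.re + 1) := by
  rw [norm_mul, Complex.norm_cpow_eq_rpow_re_of_pos hx, Complex.norm_real,
    Real.norm_of_nonneg hx.le, Real.rpow_add_one hx.ne', mul_comm]
  simp

lemma integrableOn_gaussianMoment {ν : ℂ} (hν : -1 < ν.re) {r : ℝ} (hr : 0 < r) :
    IntegrableOn (fun x : ℝ => (x : ℂ) * (x : ℂ) ^ (2 * ν) * (Real.exp (-(r * x ^ 2)) : ℂ))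
      (Ioi 0) := by
  have hI := integrableOn_rpow_mul_exp_neg_mul_sq hr (s := 2 * ν.re + 1) (by linarith)
  refine hI.mono' (by fun_prop) ?_
  filter_upwards [ae_restrict_mem measurableSet_Ioi] with x hx
  rw [norm_mul, norm_cpow_two_mul hx, Complex.norm_real, Real.norm_of_nonneg (Real.exp_pos _).le,
    neg_mul]

lemma integral_gaussianMoment {ν : ℂ} (hν : -1 < ν.re) {r : ℝ} (hr : 0 < r) :
    ∫ x in Ioi (0 : ℝ), (x : ℂ) * (x : ℂ) ^ (2 * ν) * (Real.exp (-(r * x ^ 2)) : ℂ) =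
      1 / 2 * Complex.Gamma (ν + 1) * (r : ℂ) ^ (-ν - 1) := by
  have h1 := integral_comp_rpow_Ioi_of_pos (p := 2) two_pos
    (g := fun s : ℝ => (s : ℂ) ^ (ν + 1 - 1) * Complex.exp (-(r * s)))
  rw [Complex.integral_cpow_mul_exp_neg_mul_Ioi (by simp; linarith) hr] at h1
  have h2 : ((1 / r : ℂ)) ^ (ν + 1) = (r : ℂ) ^ (-ν - 1) := by
    rw [one_div, Complex.inv_cpow _ _ (by
      rw [Complex.arg_ofReal_of_nonneg hr.le]; exact Real.pi_pos.ne), ← Complex.cpow_neg]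
    congr 1; ring
  rw [h2] at h1
  have h3 : ∫ x in Ioi (0 : ℝ), (2 : ℂ) *
      ((x : ℂ) * (x : ℂ) ^ (2 * ν) * (Real.exp (-(r * x ^ 2)) : ℂ)) =
      (r : ℂ) ^ (-ν - 1) * Complex.Gamma (ν + 1) := by
    rw [← h1]
    refine setIntegral_congr_fun measurableSet_Ioi fun x hx => ?_
    have hx : 0 < x := hx
    have hx0 : (x : ℂ) ≠ 0 := by exact_mod_cast hx.ne'
    simp only [Complex.real_smul]
    rw [show (2 : ℂ) * ν = ((2 : ℕ) : ℂ) * ν by norm_num, Complex.cpow_nat_mul]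
    norm_num
    rw [sq (x : ℂ), Complex.mul_cpow_ofReal_nonneg hx.le hx.le]
    ring_nf
  rw [integral_const_mul] at h3
  linear_combination (1 / 2) * h3

lemma integral_norm_gaussianMoment {ν : ℂ} (hν : -1 < ν.re) {r : ℝ} (hr : 0 < r) :
    ∫ x in Ioi (0 : ℝ), ‖(x : ℂ) * (x : ℂ) ^ (2 * ν) * (Real.exp (-(r * x ^ 2)) : ℂ)‖ =
      1 / 2 * Real.Gamma (ν.re + 1) * r ^ (-ν.re - 1) := by
  have h := integral_rpow_mul_exp_neg_mul_rpow two_pos (q := 2 * ν.re + 1) (by linarith) hr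
  rw [show -(2 * ν.re + 1 + 1) / 2 = -ν.re - 1 by ring,
    show (2 * ν.re + 1 + 1) / 2 = ν.re + 1 by ring] at h
  rw [show 1 / 2 * Real.Gamma (ν.re + 1) * r ^ (-ν.re - 1) =
    r ^ (-ν.re - 1) * (1 / 2) * Real.Gamma (ν.re + 1) by ring, ← h]
  refine setIntegral_congr_fun measurableSet_Ioi fun x hx => ?_
  rw [norm_mul, norm_cpow_two_mul hx, Complex.norm_real, Real.norm_of_nonneg (Real.exp_pos _).le,
    neg_mul, Real.rpow_two]

lemma parsevalWeight_two_mul (ν : ℂ) (x : ℝ) :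
    2 * parsevalWeight ν (2 * x) = (x : ℂ) * (x : ℂ) ^ (2 * ν) := by
  unfold parsevalWeight
  rw [show (2 : ℂ) * ν = ((2 : ℕ) : ℂ) * ν by norm_num, Complex.cpow_nat_mul,
    show 2 * x / 2 = x by ring]
  push_cast
  ring

lemma integrableOn_parsevalWeight {ν : ℂ} (hν : -1 < ν.re) {c : ℝ} (hc : 0 < c) :
    IntegrableOn (fun y : ℝ => parsevalWeight ν y * (Real.exp (-(c * (y ^ 2 / 4))) : ℂ))
      (Ioi 0) := by
  have h := (integrableOn_gaussianMoment hν hc).const_mul (1 / 2 : ℂ)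
  have h2 := integrableOn_Ioi_comp_mul_left_iff
    (fun y : ℝ => parsevalWeight ν y * (Real.exp (-(c * (y ^ 2 / 4))) : ℂ)) 0 (a := 2) two_pos
  rw [mul_zero] at h2
  refine h2.1 (h.congr ?_)
  refine Filter.Eventually.of_forall fun x => ?_
  simp only [← parsevalWeight_two_mul]
  ring_nf

lemma integral_parsevalWeight {ν : ℂ} (hν : -1 < ν.re) {c : ℝ} (hc : 0 < c) :
    ∫ y in Ioi (0 : ℝ), parsevalWeight ν y * (Real.exp (-(c * (y ^ 2 / 4))) : ℂ) =
      1 / 2 * Complex.Gamma (ν + 1) * (c : ℂ) ^ (-ν - 1) := by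
  rw [← integral_gaussianMoment hν hc]
  have h2 := integral_comp_mul_left_Ioi
    (fun y : ℝ => parsevalWeight ν y * (Real.exp (-(c * (y ^ 2 / 4))) : ℂ)) 0 (b := 2) two_pos
  rw [mul_zero, Complex.real_smul] at h2
  push_cast at h2
  have h3 : ∫ x in Ioi (0 : ℝ), (x : ℂ) * (x : ℂ) ^ (2 * ν) * (Real.exp (-(c * x ^ 2)) : ℂ) =
      2 * ∫ x in Ioi (0 : ℝ), parsevalWeight ν (2 * x) *
        (Real.exp (-(c * ((2 * x) ^ 2 / 4))) : ℂ) := by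
    rw [← integral_const_mul]
    refine integral_congr_ae (Filter.Eventually.of_forall fun x => ?_)
    simp only [← parsevalWeight_two_mul]
    ring_nf
  rw [h3]
  push_cast
  rw [h2]
  ring

lemma integral_norm_parsevalWeight {ν : ℂ} (hν : -1 < ν.re) {c : ℝ} (hc : 0 < c) :
    ∫ y in Ioi (0 : ℝ), ‖parsevalWeight ν y * (Real.exp (-(c * (y ^ 2 / 4))) : ℂ)‖ =
      1 / 2 * Real.Gamma (ν.re + 1) * c ^ (-ν.re - 1) := by
  rw [← integral_norm_gaussianMoment hν hc]
  have h2 := integral_comp_mul_left_Ioi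
    (fun y : ℝ => ‖parsevalWeight ν y * (Real.exp (-(c * (y ^ 2 / 4))) : ℂ)‖) 0 (b := 2) two_pos
  rw [mul_zero, smul_eq_mul] at h2
  have h3 : ∫ x in Ioi (0 : ℝ), ‖(x : ℂ) * (x : ℂ) ^ (2 * ν) * (Real.exp (-(c * x ^ 2)) : ℂ)‖ =
      2 * ∫ x in Ioi (0 : ℝ), ‖parsevalWeight ν (2 * x) *
        (Real.exp (-(c * ((2 * x) ^ 2 / 4))) : ℂ)‖ := by
    rw [← integral_const_mul]
    refine integral_congr_ae (Filter.Eventually.of_forall fun x => ?_)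
    simp only [← parsevalWeight_two_mul, norm_mul, Complex.norm_two]
    ring_nf
  rw [h3, h2]
  ring

@[fun_prop]
lemma measurable_parsevalWeight (ν : ℂ) : Measurable (parsevalWeight ν) := by
  unfold parsevalWeight; fun_prop

/-! ### The regularised Parseval identity -/

/-- The modulus, up to a constant, of the common integrand in `(p, (u, q))` to which both sides of
`integral_regularized_eq` reduce once the integration over `x` or over `y` is carried out. -/
def heatDensity (σ t : ℝ) (h : ℝ → ℂ) (s : ℝ × ℝ × ℝ) : ℝ :=
  (s.1 + s.2.2) ^ (-σ - 1) * Real.exp (-(s.1 * t ^ 2) - s.2.2 * s.2.1 ^ 2) * ‖h s.2.1‖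

lemma integral_exp_neg_mul_Ioi (ε : ℝ) {a : ℝ} (ha : 0 < a) :
    ∫ p in Ioi ε, Real.exp (-(p * a)) = Real.exp (-(ε * a)) / a := by
  have h := integral_exp_mul_Ioi (a := -a) (by linarith) ε
  rw [neg_div_neg_eq] at h
  rw [show -(ε * a) = -a * ε by ring, ← h]
  congr 1; ext p; ring_nf

lemma integrableOn_exp_neg_mul_Ioi (ε : ℝ) {a : ℝ} (ha : 0 < a) :
    IntegrableOn (fun p => Real.exp (-(p * a))) (Ioi ε) := by
  have h := integrableOn_exp_mul_Ioi (a := -a) (by linarith) ε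
  refine h.congr_fun (fun p _ => ?_) measurableSet_Ioi
  ring_nf

section

variable {μ : Measure ℝ} [SFinite μ] {ε t : ℝ} {ν : ℂ} {h : ℝ → ℂ}

omit [SFinite μ] in
lemma ae_restrict_prod_pos (hμ : ∀ᵐ u ∂μ, 0 < u) (hε : 0 ≤ ε) :
    ∀ᵐ s ∂((volume.restrict (Ioi ε)).prod (μ.prod (volume.restrict (Ioi (0 : ℝ))))),
      0 < s.1 ∧ 0 < s.2.1 ∧ 0 < s.2.2 := by
  have h1 : ∀ᵐ p ∂(volume.restrict (Ioi ε)), 0 < p := by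
    filter_upwards [ae_restrict_mem measurableSet_Ioi] with p hp
    exact lt_of_le_of_lt hε hp
  have h2 : ∀ᵐ q ∂(volume.restrict (Ioi (0 : ℝ))), 0 < q := by
    filter_upwards [ae_restrict_mem measurableSet_Ioi] with p hp using hp
  have e1 := Measure.quasiMeasurePreserving_fst (μ := volume.restrict (Ioi ε))
    (ν := μ.prod (volume.restrict (Ioi (0 : ℝ))))
  have e2 := Measure.quasiMeasurePreserving_snd (μ := volume.restrict (Ioi ε))
    (ν := μ.prod (volume.restrict (Ioi (0 : ℝ))))
  have e3 := Measure.quasiMeasurePreserving_fst (μ := μ)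
    (ν := volume.restrict (Ioi (0 : ℝ)))
  have e4 := Measure.quasiMeasurePreserving_snd (μ := μ)
    (ν := volume.restrict (Ioi (0 : ℝ)))
  filter_upwards [e1.ae h1, e2.ae (e3.ae hμ), e2.ae (e4.ae h2)] with s a b c
  exact ⟨a, b, c⟩

/-- Fubini's theorem for a kernel whose inner integrals and absolute inner integrals are known. -/
lemma integral_integral_eq_of_norm {S : Type*} [MeasurableSpace S] {m : Measure S} [SFinite m]
    {k : ℝ → S → ℂ} {D : S → ℂ} {Dr : S → ℝ}
    (hk : AEStronglyMeasurable (Function.uncurry k) ((volume.restrict (Ioi (0 : ℝ))).prod m))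
    (hi : ∀ᵐ s ∂m, IntegrableOn (fun x => k x s) (Ioi 0))
    (hD : ∀ᵐ s ∂m, ∫ x in Ioi (0 : ℝ), k x s = D s)
    (hDr : ∀ᵐ s ∂m, ∫ x in Ioi (0 : ℝ), ‖k x s‖ = Dr s) (hint : Integrable Dr m) :
    ∫ x in Ioi (0 : ℝ), ∫ s, k x s ∂m = ∫ s, D s ∂m := by
  have h1 : Integrable (Function.uncurry k) ((volume.restrict (Ioi (0 : ℝ))).prod m) := by
    rw [integrable_prod_iff' hk]
    refine ⟨hi, hint.congr ?_⟩
    filter_upwards [hDr] with s hs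
    exact hs.symm
  rw [integral_integral_swap h1]
  exact integral_congr_ae hD

/-- Integrating `x ^ (2 ν + 1) e ^ (-p (x² + t²)) e ^ (-q (x² + u²)) h(u)` over `x` first, or over
the remaining variables first. -/
lemma integral_widder_side (hμ : ∀ᵐ u ∂μ, 0 < u) (hε : 0 ≤ ε) (ht : 0 < t) (hν : -1 < ν.re)
    (hh : AEStronglyMeasurable h μ)
    (hD : Integrable (heatDensity ν.re t h)
      ((volume.restrict (Ioi ε)).prod (μ.prod (volume.restrict (Ioi (0 : ℝ))))))
    (hX : ∀ x : ℝ, 0 < x → Integrable (fun u => h u / ((u : ℂ) ^ 2 + (x : ℂ) ^ 2)) μ) :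
    ∫ x in Ioi (0 : ℝ), (x : ℂ) * (x : ℂ) ^ (2 * ν) *
        ((Real.exp (-(ε * (x ^ 2 + t ^ 2))) / (x ^ 2 + t ^ 2) : ℝ) : ℂ) *
        ∫ u, h u / ((u : ℂ) ^ 2 + (x : ℂ) ^ 2) ∂μ =
      ∫ s, 1 / 2 * Complex.Gamma (ν + 1) * ((s.1 + s.2.2 : ℝ) : ℂ) ^ (-ν - 1) *
        (Real.exp (-(s.1 * t ^ 2) - s.2.2 * s.2.1 ^ 2) : ℂ) * h s.2.1
        ∂((volume.restrict (Ioi ε)).prod (μ.prod (volume.restrict (Ioi (0 : ℝ))))) := by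
  have hpos := ae_restrict_prod_pos hμ hε
  let k : ℝ → ℝ × ℝ × ℝ → ℂ := fun x s => (x : ℂ) * (x : ℂ) ^ (2 * ν) *
    ((Real.exp (-(s.1 * (x ^ 2 + t ^ 2))) : ℂ) *
      ((Real.exp (-(s.2.2 * (s.2.1 ^ 2 + x ^ 2))) : ℂ) * h s.2.1))
  have hk1 : ∀ x s, k x s = (Real.exp (-(s.1 * t ^ 2) - s.2.2 * s.2.1 ^ 2) : ℂ) * h s.2.1 *
      ((x : ℂ) * (x : ℂ) ^ (2 * ν) * (Real.exp (-((s.1 + s.2.2) * x ^ 2)) : ℂ)) := by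
    intro x s
    have : (Real.exp (-(s.1 * (x ^ 2 + t ^ 2))) : ℂ) *
        (Real.exp (-(s.2.2 * (s.2.1 ^ 2 + x ^ 2))) : ℂ) =
        (Real.exp (-(s.1 * t ^ 2) - s.2.2 * s.2.1 ^ 2) : ℂ) *
        (Real.exp (-((s.1 + s.2.2) * x ^ 2)) : ℂ) := by
      rw [← Complex.ofReal_mul, ← Complex.ofReal_mul, ← Real.exp_add, ← Real.exp_add]
      ring_nf
    simp only [k]
    linear_combination ((x : ℂ) * (x : ℂ) ^ (2 * ν) * h s.2.1) * this
  have hmeas : AEStronglyMeasurable (Function.uncurry k) ((volume.restrict (Ioi (0 : ℝ))).prod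
      ((volume.restrict (Ioi ε)).prod (μ.prod (volume.restrict (Ioi (0 : ℝ)))))) := by
    have h1 : AEStronglyMeasurable (fun z : ℝ × ℝ × ℝ × ℝ => h z.2.2.1)
        ((volume.restrict (Ioi (0 : ℝ))).prod
        ((volume.restrict (Ioi ε)).prod (μ.prod (volume.restrict (Ioi (0 : ℝ)))))) :=
      hh.comp_fst.comp_snd.comp_snd
    unfold Function.uncurry
    simp only [k]
    refine AEStronglyMeasurable.mul ?_ (AEStronglyMeasurable.mul ?_ (AEStronglyMeasurable.mul ?_ h1))
    · exact Measurable.aestronglyMeasurable (by fun_prop)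
    · exact Measurable.aestronglyMeasurable (by fun_prop)
    · exact Measurable.aestronglyMeasurable (by fun_prop)
  have key := integral_integral_eq_of_norm hmeas
    (D := fun s => 1 / 2 * Complex.Gamma (ν + 1) * ((s.1 + s.2.2 : ℝ) : ℂ) ^ (-ν - 1) *
        (Real.exp (-(s.1 * t ^ 2) - s.2.2 * s.2.1 ^ 2) : ℂ) * h s.2.1)
    (Dr := fun s => 1 / 2 * Real.Gamma (ν.re + 1) * heatDensity ν.re t h s) ?_ ?_ ?_
    (hD.const_mul _)
  · rw [← key]
    refine setIntegral_congr_fun measurableSet_Ioi fun x hx => ?_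
    have hx : 0 < x := hx
    simp only [k]
    rw [integral_const_mul, mul_assoc]
    congr 1
    rw [integral_prod_mul (fun p => (Real.exp (-(p * (x ^ 2 + t ^ 2))) : ℂ))
      (fun z : ℝ × ℝ => (Real.exp (-(z.2 * (z.1 ^ 2 + x ^ 2))) : ℂ) * h z.1),
      integral_complex_ofReal, integral_exp_neg_mul_Ioi ε (by positivity)]
    congr 1
    rw [integral_prod]
    · refine integral_congr_ae (Filter.Eventually.of_forall fun u => ?_)
      simp only
      rw [integral_mul_const, integral_complex_ofReal, integral_exp_neg_mul_Ioi 0 (by positivity)]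
      simp only [zero_mul, neg_zero, Real.exp_zero]
      push_cast
      ring
    · rw [integrable_prod_iff]
      · refine ⟨Filter.Eventually.of_forall fun u => ?_, (hX x hx).norm.congr ?_⟩
        · have hpos' : 0 < u ^ 2 + x ^ 2 := by positivity
          exact ((integrableOn_exp_neg_mul_Ioi 0 hpos').ofReal (𝕜 := ℂ)).mul_const (h u)
        · refine Filter.Eventually.of_forall fun u => ?_
          simp only [norm_mul, Complex.norm_real, Real.norm_eq_abs, Real.abs_exp]
          rw [integral_mul_const, integral_exp_neg_mul_Ioi 0 (by positivity), norm_div]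
          simp only [zero_mul, neg_zero, Real.exp_zero]
          rw [show ((u : ℂ) ^ 2 + (x : ℂ) ^ 2) = ((u ^ 2 + x ^ 2 : ℝ) : ℂ) by push_cast; rfl,
            Complex.norm_real, Real.norm_of_nonneg (by positivity)]
          ring
      · exact AEStronglyMeasurable.mul (Measurable.aestronglyMeasurable (by fun_prop)) hh.comp_fst
  · filter_upwards [hpos] with s hs
    simp only [hk1]
    exact (integrableOn_gaussianMoment hν (by linarith [hs.1, hs.2.2])).const_mul _
  · filter_upwards [hpos] with s hs
    simp only [hk1]
    rw [integral_const_mul, integral_gaussianMoment hν (by linarith [hs.1, hs.2.2])]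
    ring
  · filter_upwards [hpos] with s hs
    have hs' : 0 < s.1 + s.2.2 := by linarith [hs.1, hs.2.2]
    simp only [hk1]
    simp only [norm_mul (_ * h _)]
    rw [integral_const_mul, integral_norm_gaussianMoment hν hs']
    unfold heatDensity
    rw [norm_mul, Complex.norm_real, Real.norm_of_nonneg (Real.exp_pos _).le]
    ring

/-- Integrating `parsevalWeight ν y * heatKernel ν y t p * heatKernel ν y u q * h u` over `y`
first, or over the remaining variables first. -/
lemma integral_macdonald_side (hμ : ∀ᵐ u ∂μ, 0 < u) (hε : 0 ≤ ε) (hν : -1 < ν.re)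
    (hh : AEStronglyMeasurable h μ)
    (hD : Integrable (heatDensity ν.re t h)
      ((volume.restrict (Ioi ε)).prod (μ.prod (volume.restrict (Ioi (0 : ℝ))))))
    (hY : ∀ y : ℝ, 0 < y → Integrable (fun u => heatIntegralR ν.re y u * ‖h u‖) μ) :
    ∫ y in Ioi (0 : ℝ), parsevalWeight ν y * heatIntegral ε ν y t *
        ∫ u, heatIntegral 0 ν y u * h u ∂μ =
      ∫ s, 1 / 2 * Complex.Gamma (ν + 1) * ((s.1 + s.2.2 : ℝ) : ℂ) ^ (-ν - 1) *
        (Real.exp (-(s.1 * t ^ 2) - s.2.2 * s.2.1 ^ 2) : ℂ) * h s.2.1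
        ∂((volume.restrict (Ioi ε)).prod (μ.prod (volume.restrict (Ioi (0 : ℝ))))) := by
  have hpos := ae_restrict_prod_pos hμ hε
  let k : ℝ → ℝ × ℝ × ℝ → ℂ := fun y s => parsevalWeight ν y *
    (heatKernel ν y t s.1 * (heatKernel ν y s.2.1 s.2.2 * h s.2.1))
  -- For fixed `p`, `q` the dependence on `y` is `exp (-(1/p + 1/q) y² / 4)`.
  have hk1 : ∀ y s, k y s = ((s.1 : ℂ) ^ (-ν - 1) * (s.2.2 : ℂ) ^ (-ν - 1) *
      (Real.exp (-(s.1 * t ^ 2) - s.2.2 * s.2.1 ^ 2) : ℂ) * h s.2.1) *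
      (parsevalWeight ν y * (Real.exp (-((s.1⁻¹ + s.2.2⁻¹) * (y ^ 2 / 4))) : ℂ)) := by
    intro y s
    have : (Real.exp (-(t ^ 2 * s.1) - y ^ 2 / (4 * s.1)) : ℂ) *
        (Real.exp (-(s.2.1 ^ 2 * s.2.2) - y ^ 2 / (4 * s.2.2)) : ℂ) =
        (Real.exp (-(s.1 * t ^ 2) - s.2.2 * s.2.1 ^ 2) : ℂ) *
        (Real.exp (-((s.1⁻¹ + s.2.2⁻¹) * (y ^ 2 / 4))) : ℂ) := by
      rw [← Complex.ofReal_mul, ← Complex.ofReal_mul, ← Real.exp_add, ← Real.exp_add]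
      congr 2
      rw [div_eq_mul_inv, div_eq_mul_inv, mul_inv, mul_inv]
      ring
    simp only [k, heatKernel]
    linear_combination (parsevalWeight ν y * h s.2.1 * (s.1 : ℂ) ^ (-ν - 1) *
      (s.2.2 : ℂ) ^ (-ν - 1)) * this
  have hmeas : AEStronglyMeasurable (Function.uncurry k) ((volume.restrict (Ioi (0 : ℝ))).prod
      ((volume.restrict (Ioi ε)).prod (μ.prod (volume.restrict (Ioi (0 : ℝ)))))) := by
    have h1 : AEStronglyMeasurable (fun z : ℝ × ℝ × ℝ × ℝ => h z.2.2.1)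
        ((volume.restrict (Ioi (0 : ℝ))).prod
        ((volume.restrict (Ioi ε)).prod (μ.prod (volume.restrict (Ioi (0 : ℝ)))))) :=
      hh.comp_fst.comp_snd.comp_snd
    unfold Function.uncurry
    simp only [k]
    refine AEStronglyMeasurable.mul ?_ (AEStronglyMeasurable.mul ?_ (AEStronglyMeasurable.mul ?_ h1))
    · exact Measurable.aestronglyMeasurable (by fun_prop)
    · exact Measurable.aestronglyMeasurable (by fun_prop)
    · exact Measurable.aestronglyMeasurable (by fun_prop)
  have key := integral_integral_eq_of_norm hmeas
    (D := fun s => 1 / 2 * Complex.Gamma (ν + 1) * ((s.1 + s.2.2 : ℝ) : ℂ) ^ (-ν - 1) *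
        (Real.exp (-(s.1 * t ^ 2) - s.2.2 * s.2.1 ^ 2) : ℂ) * h s.2.1)
    (Dr := fun s => 1 / 2 * Real.Gamma (ν.re + 1) * heatDensity ν.re t h s) ?_ ?_ ?_
    (hD.const_mul _)
  · rw [← key]
    refine setIntegral_congr_fun measurableSet_Ioi fun y hy => ?_
    have hy : 0 < y := hy
    simp only [k]
    rw [integral_const_mul, mul_assoc]
    congr 1
    rw [integral_prod_mul (fun p => heatKernel ν y t p)
      (fun z : ℝ × ℝ => heatKernel ν y z.1 z.2 * h z.1)]
    congr 1
    rw [integral_prod]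
    · simp only [integral_mul_const]
      rfl
    · rw [integrable_prod_iff]
      · refine ⟨?_, (hY y hy).congr ?_⟩
        · filter_upwards [hμ] with u hu
          exact (integrableOn_heatKernel ν hy hu).mul_const _
        · refine Filter.Eventually.of_forall fun u => ?_
          simp only [norm_mul]
          rw [integral_mul_const]
          congr 1
          exact setIntegral_congr_fun measurableSet_Ioi fun q hq => (norm_heatKernel ν y u hq).symm
      · exact AEStronglyMeasurable.mul (Measurable.aestronglyMeasurable (by fun_prop)) hh.comp_fst
  · filter_upwards [hpos] with s hs
    have h1 := hs.1
    have h2 := hs.2.2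
    simp only [hk1]
    exact (integrableOn_parsevalWeight hν (by positivity)).const_mul _
  · filter_upwards [hpos] with s hs
    have h1 := hs.1
    have h2 := hs.2.2
    simp only [hk1]
    rw [integral_const_mul, integral_parsevalWeight hν (by positivity)]
    have : (s.1 : ℂ) ^ (-ν - 1) * (s.2.2 : ℂ) ^ (-ν - 1) *
        ((s.1⁻¹ + s.2.2⁻¹ : ℝ) : ℂ) ^ (-ν - 1) = ((s.1 + s.2.2 : ℝ) : ℂ) ^ (-ν - 1) := by
      rw [← Complex.mul_cpow_ofReal_nonneg h1.le h2.le, ← Complex.ofReal_mul,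
        ← Complex.mul_cpow_ofReal_nonneg (by positivity) (by positivity), ← Complex.ofReal_mul]
      congr 2
      field_simp
      ring
    rw [← this]
    ring
  · filter_upwards [hpos] with s hs
    have h1 := hs.1
    have h2 := hs.2.2
    simp only [hk1]
    simp only [norm_mul (_ * h _)]
    rw [integral_const_mul, integral_norm_parsevalWeight hν (by positivity)]
    unfold heatDensity
    have : s.1 ^ (-ν.re - 1) * s.2.2 ^ (-ν.re - 1) * (s.1⁻¹ + s.2.2⁻¹) ^ (-ν.re - 1) =
        (s.1 + s.2.2) ^ (-ν.re - 1) := by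
      rw [← Real.mul_rpow h1.le h2.le, ← Real.mul_rpow (by positivity) (by positivity)]
      congr 1
      field_simp
      ring
    rw [← this, norm_mul, norm_mul, norm_mul, Complex.norm_real,
      Real.norm_of_nonneg (Real.exp_pos _).le, Complex.norm_cpow_eq_rpow_re_of_pos h1,
      Complex.norm_cpow_eq_rpow_re_of_pos h2]
    simp only [Complex.sub_re, Complex.neg_re, Complex.one_re]
    ring

/-- The Parseval-type identity behind the theorem, for an arbitrary measure in the variable `u`. The
two sides agree because both integrate `heatDensity`, with its phase, over `(p, (u, q))`. -/
theorem integral_regularized_eq (hμ : ∀ᵐ u ∂μ, 0 < u) (hε : 0 ≤ ε) (ht : 0 < t)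
    (hν : -1 < ν.re) (hh : AEStronglyMeasurable h μ)
    (hD : Integrable (heatDensity ν.re t h)
      ((volume.restrict (Ioi ε)).prod (μ.prod (volume.restrict (Ioi (0 : ℝ))))))
    (hX : ∀ x : ℝ, 0 < x → Integrable (fun u => h u / ((u : ℂ) ^ 2 + (x : ℂ) ^ 2)) μ)
    (hY : ∀ y : ℝ, 0 < y → Integrable (fun u => heatIntegralR ν.re y u * ‖h u‖) μ) :
    ∫ x in Ioi (0 : ℝ), (x : ℂ) * (x : ℂ) ^ (2 * ν) *
        ((Real.exp (-(ε * (x ^ 2 + t ^ 2))) / (x ^ 2 + t ^ 2) : ℝ) : ℂ) *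
        ∫ u, h u / ((u : ℂ) ^ 2 + (x : ℂ) ^ 2) ∂μ =
      ∫ y in Ioi (0 : ℝ), parsevalWeight ν y * heatIntegral ε ν y t *
        ∫ u, heatIntegral 0 ν y u * h u ∂μ := by
  rw [integral_widder_side hμ hε ht hν hh hD hX, integral_macdonald_side hμ hε hν hh hD hY]

end

/-! ### Removing the regularisation -/

lemma integrable_norm_div_one_add_sq {μ : Measure ℝ} {h : ℝ → ℂ}
    (hX : ∀ x : ℝ, 0 < x → Integrable (fun u => h u / ((u : ℂ) ^ 2 + (x : ℂ) ^ 2)) μ) :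
    Integrable (fun u => ‖h u‖ / (1 + u ^ 2)) μ := by
  refine (hX 1 one_pos).norm.congr (Filter.Eventually.of_forall fun u => ?_)
  simp only
  rw [norm_div, show ((u : ℂ) ^ 2 + ((1 : ℝ) : ℂ) ^ 2) = ((1 + u ^ 2 : ℝ) : ℂ) by push_cast; ring,
    Complex.norm_real, Real.norm_of_nonneg (by positivity)]

/-- For a positive regularisation parameter the common integrand is absolutely integrable. For
`q ≥ 1` the factor `(p + q) ^ (-σ - 1)` is compared with `q ^ (-σ - 1)`, for `q ≤ 1` with
`ε ^ (-σ - 1)`. -/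
lemma integrable_heatDensity {ε σ t : ℝ} {h : ℝ → ℂ} (hε : 0 < ε) (ht : 0 < t) (hσ : -1 < σ)
    (hh : AEStronglyMeasurable h (volume.restrict (Ioi (0 : ℝ))))
    (hX : Integrable (fun u => ‖h u‖ / (1 + u ^ 2)) (volume.restrict (Ioi (0 : ℝ))))
    (hY : Integrable (fun u => heatIntegralR σ 1 u * ‖h u‖) (volume.restrict (Ioi (0 : ℝ)))) :
    Integrable (heatDensity σ t h) ((volume.restrict (Ioi ε)).prod
      ((volume.restrict (Ioi (0 : ℝ))).prod (volume.restrict (Ioi (0 : ℝ))))) := by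
  have hpos := ae_restrict_prod_pos (μ := volume.restrict (Ioi (0 : ℝ))) (ε := ε)
    (ae_restrict_mem measurableSet_Ioi) hε.le
  have hp : ∀ᵐ s ∂((volume.restrict (Ioi ε)).prod
      ((volume.restrict (Ioi (0 : ℝ))).prod (volume.restrict (Ioi (0 : ℝ))))), ε < s.1 :=
    Measure.quasiMeasurePreserving_fst.ae (ae_restrict_mem measurableSet_Ioi)
  have i1 : Integrable (fun z : ℝ × ℝ => heatKernelR σ 1 z.1 z.2 * ‖h z.1‖)
      ((volume.restrict (Ioi (0 : ℝ))).prod (volume.restrict (Ioi (0 : ℝ)))) := by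
    rw [integrable_prod_iff]
    · refine ⟨?_, hY.congr ?_⟩
      · filter_upwards [ae_restrict_mem measurableSet_Ioi] with u hu
        exact (integrableOn_heatKernelR σ one_pos hu).mul_const _
      · refine Filter.Eventually.of_forall fun u => ?_
        simp only [norm_mul, norm_norm]
        rw [integral_mul_const]
        congr 1
        exact setIntegral_congr_fun measurableSet_Ioi fun q hq =>
          (Real.norm_of_nonneg (heatKernelR_nonneg σ 1 u hq)).symm
    · refine AEStronglyMeasurable.mul (Measurable.aestronglyMeasurable ?_) hh.norm.comp_fst
      unfold heatKernelR
      fun_prop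
  have i2 : Integrable (fun z : ℝ × ℝ => Real.exp (-(z.2 * (1 + z.1 ^ 2))) * ‖h z.1‖)
      ((volume.restrict (Ioi (0 : ℝ))).prod (volume.restrict (Ioi (0 : ℝ)))) := by
    rw [integrable_prod_iff]
    · refine ⟨Filter.Eventually.of_forall fun u => ?_, hX.congr ?_⟩
      · have hpos' : 0 < 1 + u ^ 2 := by positivity
        exact (integrableOn_exp_neg_mul_Ioi 0 hpos').mul_const ‖h u‖
      · refine Filter.Eventually.of_forall fun u => ?_
        simp only [norm_mul, norm_norm, Real.norm_of_nonneg (Real.exp_pos _).le]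
        rw [integral_mul_const, integral_exp_neg_mul_Ioi 0 (by positivity)]
        simp only [zero_mul, neg_zero, Real.exp_zero]
        ring
    · exact AEStronglyMeasurable.mul (Measurable.aestronglyMeasurable (by fun_prop))
        hh.norm.comp_fst
  have i3 := (integrableOn_exp_neg_mul_Ioi ε (pow_pos ht 2)).mul_prod
    ((i1.const_mul (Real.exp (1 / 4))).add (i2.const_mul (ε ^ (-σ - 1) * Real.exp 1)))
  refine i3.mono' ?_ ?_
  · unfold heatDensity
    exact AEStronglyMeasurable.mul (Measurable.aestronglyMeasurable (by fun_prop))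
      hh.norm.comp_fst.comp_snd
  · filter_upwards [hpos, hp] with s hs hsp
    obtain ⟨h1, h2, h3⟩ := hs
    obtain ⟨p, u, q⟩ := s
    simp only at h1 h2 h3 hsp
    have hpq : 0 < p + q := by linarith
    simp only [heatDensity, Pi.add_apply]
    rw [Real.norm_of_nonneg (by positivity), sub_eq_add_neg (-(p * t ^ 2)), Real.exp_add]
    have key : (p + q) ^ (-σ - 1) * Real.exp (-(q * u ^ 2)) ≤
        Real.exp (1 / 4) * heatKernelR σ 1 u q +
          ε ^ (-σ - 1) * Real.exp 1 * Real.exp (-(q * (1 + u ^ 2))) := by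
      have hk := heatKernelR_nonneg σ 1 u h3
      rcases le_total 1 q with hq | hq
      · have e1 : (p + q) ^ (-σ - 1) ≤ q ^ (-σ - 1) :=
          Real.rpow_le_rpow_of_nonpos h3 (by linarith) (by linarith)
        have e2 : Real.exp (-(q * u ^ 2)) ≤
            Real.exp (1 / 4) * Real.exp (-(u ^ 2 * q) - 1 ^ 2 / (4 * q)) := by
          rw [← Real.exp_add]
          apply Real.exp_le_exp.2
          have : 1 ^ 2 / (4 * q) ≤ 1 / 4 := by
            rw [div_le_div_iff₀ (by positivity) (by positivity)]; linarith
          nlinarith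
        calc _ ≤ q ^ (-σ - 1) * (Real.exp (1 / 4) * Real.exp (-(u ^ 2 * q) - 1 ^ 2 / (4 * q))) := by
              gcongr
          _ = Real.exp (1 / 4) * heatKernelR σ 1 u q := by unfold heatKernelR; ring
          _ ≤ _ := le_add_of_nonneg_right (by positivity)
      · have e1 : (p + q) ^ (-σ - 1) ≤ ε ^ (-σ - 1) :=
          Real.rpow_le_rpow_of_nonpos hε (by linarith) (by linarith)
        have e2 : Real.exp (-(q * u ^ 2)) ≤ Real.exp 1 * Real.exp (-(q * (1 + u ^ 2))) := by
          rw [← Real.exp_add]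
          apply Real.exp_le_exp.2
          linarith
        calc _ ≤ ε ^ (-σ - 1) * (Real.exp 1 * Real.exp (-(q * (1 + u ^ 2)))) := by gcongr
          _ = ε ^ (-σ - 1) * Real.exp 1 * Real.exp (-(q * (1 + u ^ 2))) := by ring
          _ ≤ _ := le_add_of_nonneg_left (by positivity)
    calc _ = Real.exp (-(p * t ^ 2)) * ‖h u‖ *
          ((p + q) ^ (-σ - 1) * Real.exp (-(q * u ^ 2))) := by ring
      _ ≤ Real.exp (-(p * t ^ 2)) * ‖h u‖ * (Real.exp (1 / 4) * heatKernelR σ 1 u q +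
          ε ^ (-σ - 1) * Real.exp 1 * Real.exp (-(q * (1 + u ^ 2)))) := by gcongr
      _ = _ := by ring

lemma tendsto_heatIntegral (ν : ℂ) {y t : ℝ} (hy : 0 < y) (ht : 0 < t) :
    Filter.Tendsto (fun n : ℕ => heatIntegral (1 / ((n : ℝ) + 1)) ν y t) Filter.atTop
      (nhds (heatIntegral 0 ν y t)) := by
  have hU : ⋃ n : ℕ, Ioi (1 / ((n : ℝ) + 1)) = Ioi (0 : ℝ) := by
    ext p
    simp only [mem_iUnion, mem_Ioi]
    exact ⟨fun ⟨n, hn⟩ => lt_trans (by positivity) hn, fun hp => exists_nat_one_div_lt hp⟩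
  have h := tendsto_setIntegral_of_monotone (μ := volume) (f := heatKernel ν y t)
    (s := fun n : ℕ => Ioi (1 / ((n : ℝ) + 1))) (fun _ => measurableSet_Ioi)
    (fun m n hmn => Ioi_subset_Ioi (Nat.one_div_le_one_div hmn))
    (by rw [hU]; exact integrableOn_heatKernel ν hy ht)
  rw [hU] at h
  exact h

lemma aestronglyMeasurable_integral_heatIntegral (ν : ℂ) {h : ℝ → ℂ} {μ : Measure ℝ} [SFinite μ]
    (m : Measure ℝ) (hh : AEStronglyMeasurable h μ) :
    AEStronglyMeasurable (fun y => ∫ u, heatIntegral 0 ν y u * h u ∂μ) m := by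
  refine AEStronglyMeasurable.integral_prod_right' (f := fun z : ℝ × ℝ =>
    heatIntegral 0 ν z.1 z.2 * h z.2) (AEStronglyMeasurable.mul ?_ hh.comp_snd)
  exact (stronglyMeasurable_heatIntegral 0 ν measurable_fst measurable_snd).aestronglyMeasurable

/-- The Parseval-type identity without regularisation, under the existence of the integral over `x`
and the absolute convergence of a majorant of the integral over `y`. -/
theorem integral_eq_of_dominated {ν : ℂ} {t : ℝ} {h : ℝ → ℂ} (ht : 0 < t) (hν : -1 < ν.re)
    (hh : AEStronglyMeasurable h (volume.restrict (Ioi (0 : ℝ))))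
    (hX : ∀ x : ℝ, 0 < x → IntegrableOn (fun u => h u / ((u : ℂ) ^ 2 + (x : ℂ) ^ 2)) (Ioi 0))
    (hY : ∀ y : ℝ, 0 < y → IntegrableOn (fun u => heatIntegralR ν.re y u * ‖h u‖) (Ioi 0))
    (hL : IntegrableOn (fun x : ℝ => (x : ℂ) * (x : ℂ) ^ (2 * ν) * ((1 / (x ^ 2 + t ^ 2) : ℝ) : ℂ) *
      ∫ u in Ioi (0 : ℝ), h u / ((u : ℂ) ^ 2 + (x : ℂ) ^ 2)) (Ioi 0))
    (hR : IntegrableOn (fun y : ℝ => ‖parsevalWeight ν y‖ * heatIntegralR ν.re y t *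
      ‖∫ u in Ioi (0 : ℝ), heatIntegral 0 ν y u * h u‖) (Ioi 0)) :
    ∫ x in Ioi (0 : ℝ), (x : ℂ) * (x : ℂ) ^ (2 * ν) * ((1 / (x ^ 2 + t ^ 2) : ℝ) : ℂ) *
        ∫ u in Ioi (0 : ℝ), h u / ((u : ℂ) ^ 2 + (x : ℂ) ^ 2) =
      ∫ y in Ioi (0 : ℝ), parsevalWeight ν y * heatIntegral 0 ν y t *
        ∫ u in Ioi (0 : ℝ), heatIntegral 0 ν y u * h u := by
  have hreg : ∀ n : ℕ, _ := fun n => integral_regularized_eq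
    (μ := volume.restrict (Ioi (0 : ℝ))) (ae_restrict_mem measurableSet_Ioi)
    (ε := 1 / ((n : ℝ) + 1)) (by positivity) ht hν hh
    (integrable_heatDensity (by positivity) ht hν hh (integrable_norm_div_one_add_sq hX)
      (hY 1 one_pos)) hX hY
  have hsplit : ∀ (n : ℕ) (x : ℝ),
      ((Real.exp (-(1 / ((n : ℝ) + 1) * (x ^ 2 + t ^ 2))) / (x ^ 2 + t ^ 2) : ℝ) : ℂ) =
      ((1 / (x ^ 2 + t ^ 2) : ℝ) : ℂ) *
        (Real.exp (-(1 / ((n : ℝ) + 1) * (x ^ 2 + t ^ 2))) : ℂ) := by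
    intro n x
    rw [← Complex.ofReal_mul]
    congr 1
    ring
  have limL : Filter.Tendsto (fun n : ℕ => ∫ x in Ioi (0 : ℝ), (x : ℂ) * (x : ℂ) ^ (2 * ν) *
        ((Real.exp (-(1 / ((n : ℝ) + 1) * (x ^ 2 + t ^ 2))) / (x ^ 2 + t ^ 2) : ℝ) : ℂ) *
        ∫ u in Ioi (0 : ℝ), h u / ((u : ℂ) ^ 2 + (x : ℂ) ^ 2)) Filter.atTop
      (nhds (∫ x in Ioi (0 : ℝ), (x : ℂ) * (x : ℂ) ^ (2 * ν) * ((1 / (x ^ 2 + t ^ 2) : ℝ) : ℂ) *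
        ∫ u in Ioi (0 : ℝ), h u / ((u : ℂ) ^ 2 + (x : ℂ) ^ 2))) := by
    refine tendsto_integral_of_dominated_convergence _ (fun n => ?_) hL.norm (fun n => ?_) ?_
    · refine AEStronglyMeasurable.congr (f := fun x : ℝ =>
        (Real.exp (-(1 / ((n : ℝ) + 1) * (x ^ 2 + t ^ 2))) : ℂ) *
        ((x : ℂ) * (x : ℂ) ^ (2 * ν) * ((1 / (x ^ 2 + t ^ 2) : ℝ) : ℂ) *
        ∫ u in Ioi (0 : ℝ), h u / ((u : ℂ) ^ 2 + (x : ℂ) ^ 2)))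
        (AEStronglyMeasurable.mul (by fun_prop) hL.1) ?_
      refine Filter.Eventually.of_forall fun x => ?_
      simp only
      rw [hsplit]
      ring
    · refine Filter.Eventually.of_forall fun x => ?_
      rw [hsplit, ← mul_assoc _ _ (Complex.ofReal _), mul_right_comm _ (Complex.ofReal (Real.exp _)),
        norm_mul _ (Complex.ofReal (Real.exp _)), Complex.norm_real, Real.norm_of_nonneg (Real.exp_pos _).le]
      refine mul_le_of_le_one_right (norm_nonneg _) (Real.exp_le_one_iff.2 ?_)
      have : 0 ≤ 1 / ((n : ℝ) + 1) * (x ^ 2 + t ^ 2) := by positivity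
      linarith
    · refine Filter.Eventually.of_forall fun x => ?_
      have e1 : Filter.Tendsto (fun n : ℕ => Real.exp (-(1 / ((n : ℝ) + 1) * (x ^ 2 + t ^ 2))))
          Filter.atTop (nhds 1) := by
        have := ((tendsto_one_div_add_atTop_nhds_zero_nat (𝕜 := ℝ)).mul_const
          (x ^ 2 + t ^ 2)).neg.rexp
        simpa using this
      have e2 := (((Complex.continuous_ofReal.tendsto 1).comp e1).const_mul
        ((x : ℂ) * (x : ℂ) ^ (2 * ν) * ((1 / (x ^ 2 + t ^ 2) : ℝ) : ℂ))).mul_const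
        (∫ u in Ioi (0 : ℝ), h u / ((u : ℂ) ^ 2 + (x : ℂ) ^ 2))
      simp only [Complex.ofReal_one, mul_one] at e2
      refine e2.congr fun n => ?_
      rw [hsplit]
      simp only [Function.comp_apply]
      ring
  have limR : Filter.Tendsto (fun n : ℕ => ∫ y in Ioi (0 : ℝ), parsevalWeight ν y *
        heatIntegral (1 / ((n : ℝ) + 1)) ν y t *
        ∫ u in Ioi (0 : ℝ), heatIntegral 0 ν y u * h u) Filter.atTop
      (nhds (∫ y in Ioi (0 : ℝ), parsevalWeight ν y * heatIntegral 0 ν y t *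
        ∫ u in Ioi (0 : ℝ), heatIntegral 0 ν y u * h u)) := by
    refine tendsto_integral_of_dominated_convergence _ (fun n => ?_) hR (fun n => ?_) ?_
    · refine AEStronglyMeasurable.mul (AEStronglyMeasurable.mul (by fun_prop) ?_)
        (aestronglyMeasurable_integral_heatIntegral ν _ hh)
      exact (stronglyMeasurable_heatIntegral _ ν measurable_id
        measurable_const).aestronglyMeasurable
    · filter_upwards [ae_restrict_mem measurableSet_Ioi] with y hy
      rw [norm_mul, norm_mul]
      gcongr
      exact norm_heatIntegral_le (by positivity) ν hy ht
    · filter_upwards [ae_restrict_mem measurableSet_Ioi] with y hy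
      exact ((tendsto_heatIntegral ν hy ht).const_mul _).mul_const _
  refine tendsto_nhds_unique limL (limR.congr fun n => ?_)
  exact (hreg n).symm

lemma image_mul_exp_univ {c : ℝ} (hc : 0 < c) :
    (fun s => c * Real.exp s) '' univ = Ioi (0 : ℝ) := by
  ext p
  simp only [image_univ, mem_range, mem_Ioi]
  constructor
  · rintro ⟨s, rfl⟩; positivity
  · intro hp
    refine ⟨Real.log (p / c), ?_⟩
    rw [Real.exp_log (by positivity)]
    field_simp

lemma integral_Ioi_zero_eq_integral_exp (f : ℝ → ℂ) {c : ℝ} (hc : 0 < c) :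
    ∫ p in Ioi (0 : ℝ), f p = ∫ s : ℝ, (c * Real.exp s) • f (c * Real.exp s) := by
  have h := integral_image_eq_integral_abs_deriv_smul (s := univ) MeasurableSet.univ
    (f := fun s => c * Real.exp s) (f' := fun s => c * Real.exp s)
    (fun s _ => ((Real.hasDerivAt_exp s).const_mul c).hasDerivWithinAt)
    (fun a _ b _ hab => Real.exp_injective (mul_left_cancel₀ hc.ne' hab)) f
  rw [image_mul_exp_univ hc, setIntegral_univ] at h
  rw [h]
  refine integral_congr_ae (Filter.Eventually.of_forall fun s => ?_)
  simp only
  rw [abs_of_pos (by positivity)]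

lemma integrableOn_Ioi_zero_iff_integrable_exp (f : ℝ → ℂ) {c : ℝ} (hc : 0 < c) :
    IntegrableOn f (Ioi 0) ↔ Integrable fun s : ℝ => (c * Real.exp s) • f (c * Real.exp s) := by
  have h := integrableOn_image_iff_integrableOn_abs_deriv_smul (s := univ) MeasurableSet.univ
    (f := fun s => c * Real.exp s) (f' := fun s => c * Real.exp s)
    (fun s _ => ((Real.hasDerivAt_exp s).const_mul c).hasDerivWithinAt)
    (fun a _ b _ hab => Real.exp_injective (mul_left_cancel₀ hc.ne' hab)) f
  rw [image_mul_exp_univ hc, integrableOn_univ] at h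
  rw [h]
  refine integrable_congr (Filter.Eventually.of_forall fun s => ?_)
  simp only
  rw [abs_of_pos (by positivity)]

/-- In the variable `s` with `p = (y / (2 u)) e ^ s`, the exponent `-u² p - y² / (4 p)` becomes
`-u y cosh s`. -/
lemma smul_heatKernel_exp (ν : ℂ) {y u : ℝ} (hy : 0 < y) (hu : 0 < u) (s : ℝ) :
    (y / (2 * u) * Real.exp s) • heatKernel ν y u (y / (2 * u) * Real.exp s) =
      ((y / (2 * u) : ℝ) : ℂ) ^ (-ν) *
        ((Real.exp (-(u * y) * Real.cosh s) : ℂ) * Complex.exp (-(ν * s))) := by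
  have hc : 0 < y / (2 * u) := by positivity
  have hp : 0 < y / (2 * u) * Real.exp s := by positivity
  have hp0 : ((y / (2 * u) * Real.exp s : ℝ) : ℂ) ≠ 0 := by exact_mod_cast hp.ne'
  have e1 : -(u ^ 2 * (y / (2 * u) * Real.exp s)) - y ^ 2 / (4 * (y / (2 * u) * Real.exp s)) =
      -(u * y) * Real.cosh s := by
    rw [Real.cosh_eq, Real.exp_neg]
    field_simp
    ring
  have e2 : ((y / (2 * u) * Real.exp s : ℝ) : ℂ) * ((y / (2 * u) * Real.exp s : ℝ) : ℂ) ^ (-ν - 1) =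
      ((y / (2 * u) : ℝ) : ℂ) ^ (-ν) * Complex.exp (-(ν * s)) := by
    rw [Complex.cpow_sub _ _ hp0, Complex.cpow_one, mul_div_cancel₀ _ hp0, Complex.ofReal_mul,
      Complex.mul_cpow_ofReal_nonneg hc.le (Real.exp_pos s).le]
    congr 1
    rw [Complex.cpow_def_of_ne_zero (by exact_mod_cast (Real.exp_pos s).ne'),
      ← Complex.ofReal_log (Real.exp_pos s).le, Real.log_exp]
    ring_nf
  rw [Complex.real_smul, heatKernel, e1, ← mul_assoc, e2]
  ring

lemma integrable_exp_cosh_mul_exp (ν : ℂ) {z : ℝ} (hz : 0 < z) :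
    Integrable fun s : ℝ => (Real.exp (-z * Real.cosh s) : ℂ) * Complex.exp (-(ν * s)) := by
  have hc : (0 : ℝ) < z / (2 * 1) := by positivity
  have h := (integrableOn_Ioi_zero_iff_integrable_exp _ hc).1
    (integrableOn_heatKernel ν hz one_pos)
  simp only [smul_heatKernel_exp ν hz one_pos, one_mul] at h
  have h0 : ((z / (2 * 1) : ℝ) : ℂ) ^ (-ν) ≠ 0 := by
    rw [Ne, Complex.cpow_eq_zero_iff]
    exact fun h => hc.ne' (by exact_mod_cast h.1)
  exact (h.const_mul (((z / (2 * 1) : ℝ) : ℂ) ^ (-ν))⁻¹).congr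
    (Filter.Eventually.of_forall fun s => inv_mul_cancel_left₀ h0 _)

lemma integral_exp_cosh_mul_exp (ν : ℂ) {z : ℝ} (hz : 0 < z) :
    ∫ s : ℝ, (Real.exp (-z * Real.cosh s) : ℂ) * Complex.exp (-(ν * s)) =
      2 * macdonaldK ν z := by
  have hI := integrable_exp_cosh_mul_exp ν hz
  have hneg : ∫ s in Iic (0 : ℝ), (Real.exp (-z * Real.cosh s) : ℂ) * Complex.exp (-(ν * s)) =
      ∫ s in Ioi (0 : ℝ), (Real.exp (-z * Real.cosh s) : ℂ) * Complex.exp (ν * s) := by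
    have h := integral_comp_neg_Ioi (0 : ℝ)
      (fun s : ℝ => (Real.exp (-z * Real.cosh s) : ℂ) * Complex.exp (-(ν * s)))
    rw [neg_zero] at h
    rw [← h]
    simp
  have hI2 : IntegrableOn
      (fun s : ℝ => (Real.exp (-z * Real.cosh s) : ℂ) * Complex.exp (ν * s)) (Ioi 0) := by
    have h := (integrable_exp_cosh_mul_exp (-ν) hz).integrableOn (s := Ioi 0)
    simpa using h
  rw [← intervalIntegral.integral_Iic_add_Ioi hI.integrableOn hI.integrableOn, hneg,
    ← integral_add hI2 hI.integrableOn, macdonaldK, ← integral_const_mul]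
  refine setIntegral_congr_fun measurableSet_Ioi fun s _ => ?_
  simp only [Complex.cosh]
  ring

theorem cpow_mul_macdonaldK (ν : ℂ) {y u : ℝ} (hy : 0 < y) (hu : 0 < u) :
    (u : ℂ) ^ ν * macdonaldK ν (u * y) =
      1 / 2 * ((y / 2 : ℝ) : ℂ) ^ ν * heatIntegral 0 ν y u := by
  have hc : 0 < y / (2 * u) := by positivity
  have h0 : ((y / (2 * u) : ℝ) : ℂ) ≠ 0 := by exact_mod_cast hc.ne'
  unfold heatIntegral
  rw [integral_Ioi_zero_eq_integral_exp _ hc]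
  simp only [smul_heatKernel_exp ν hy hu]
  rw [integral_const_mul, integral_exp_cosh_mul_exp ν (mul_pos hu hy)]
  have e : ((y / 2 : ℝ) : ℂ) ^ ν = (u : ℂ) ^ ν * ((y / (2 * u) : ℝ) : ℂ) ^ ν := by
    rw [← Complex.mul_cpow_ofReal_nonneg hu.le hc.le, ← Complex.ofReal_mul]
    congr 2
    field_simp
  have e2 : ((y / (2 * u) : ℝ) : ℂ) ^ ν * ((y / (2 * u) : ℝ) : ℂ) ^ (-ν) = 1 := by
    rw [← Complex.cpow_add _ _ h0, add_neg_cancel, Complex.cpow_zero]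
  rw [e]
  linear_combination (-(u : ℂ) ^ ν * macdonaldK ν (u * y)) * e2

lemma macdonaldK_neg (ν : ℂ) (z : ℝ) : macdonaldK (-ν) z = macdonaldK ν z := by
  unfold macdonaldK
  simp only [neg_mul, Complex.cosh_neg]

lemma norm_macdonaldK_re {σ y u : ℝ} (hy : 0 < y) (hu : 0 < u) :
    u ^ σ * ‖macdonaldK σ (u * y)‖ = 1 / 2 * (y / 2) ^ σ * heatIntegralR σ y u := by
  have h := congrArg norm (cpow_mul_macdonaldK (σ : ℂ) hy hu)
  rw [heatIntegral_ofReal, norm_mul, norm_mul, norm_mul, Complex.norm_cpow_eq_rpow_re_of_pos hu,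
    Complex.norm_cpow_eq_rpow_re_of_pos (by positivity : 0 < y / 2), Complex.norm_real,
    Real.norm_of_nonneg (heatIntegralR_nonneg _ _ _)] at h
  simpa using h

lemma norm_macdonaldK {ν : ℂ} {y u : ℝ} (hy : 0 < y) (hu : 0 < u) :
    u ^ ν.re * ‖macdonaldK ν (u * y)‖ = 1 / 2 * (y / 2) ^ ν.re * ‖heatIntegral 0 ν y u‖ := by
  have h := congrArg norm (cpow_mul_macdonaldK ν hy hu)
  rw [norm_mul, norm_mul, norm_mul, Complex.norm_cpow_eq_rpow_re_of_pos hu,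
    Complex.norm_cpow_eq_rpow_re_of_pos (by positivity : 0 < y / 2)] at h
  simpa using h

/-! ### Comparison of `K_ν` with `K_{Re ν}` near the origin -/

lemma tendsto_heatIntegral_Gamma {ν : ℂ} (hν : ν.re < 0) :
    Filter.Tendsto (fun y => heatIntegral 0 ν y 1) (nhdsWithin 0 (Ioi 0))
      (nhds (Complex.Gamma (-ν))) := by
  have hre : 0 < (-ν).re := by simpa using hν
  rw [Complex.Gamma_eq_integral hre, Complex.GammaIntegral]
  unfold heatIntegral
  have hb := Real.GammaIntegral_convergent (s := -ν.re) (by linarith)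
  refine tendsto_integral_filter_of_dominated_convergence _
    (Filter.Eventually.of_forall fun y => by fun_prop)
    (Filter.Eventually.of_forall fun y => ?_) hb ?_
  · filter_upwards [ae_restrict_mem measurableSet_Ioi] with p hp
    rw [norm_heatKernel ν y 1 hp, heatKernelR, mul_comm]
    have hp : 0 < p := hp
    gcongr
    have : 0 ≤ y ^ 2 / (4 * p) := by positivity
    linarith
  · filter_upwards [ae_restrict_mem measurableSet_Ioi] with p hp
    have h : Filter.Tendsto (fun y : ℝ => heatKernel ν y 1 p) (nhds 0)
        (nhds (heatKernel ν 0 1 p)) := by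
      have : Continuous fun y : ℝ => heatKernel ν y 1 p := by unfold heatKernel; fun_prop
      exact this.tendsto 0
    have e : heatKernel ν 0 1 p = (Real.exp (-p) : ℂ) * (p : ℂ) ^ (-ν - 1) := by
      simp [heatKernel, mul_comm]
    rw [← e]
    exact h.mono_left nhdsWithin_le_nhds

lemma exists_heatIntegralR_le_of_re_neg {ν : ℂ} (hν : ν.re < 0) :
    ∃ C z₀ : ℝ, 0 < z₀ ∧ ∀ y, 0 < y → y ≤ z₀ →
      heatIntegralR ν.re y 1 ≤ C * ‖heatIntegral 0 ν y 1‖ := by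
  have hre : 0 < (-ν).re := by simpa using hν
  have hG : 0 < ‖Complex.Gamma (-ν)‖ := norm_pos_iff.2 (Complex.Gamma_ne_zero_of_re_pos hre)
  have h1 := (tendsto_heatIntegral_Gamma hν).norm.eventually
    (lt_mem_nhds (half_lt_self hG))
  have h2 := (tendsto_heatIntegral_Gamma (ν := (ν.re : ℂ)) (by simpa using hν)).norm.eventually
    (gt_mem_nhds (lt_add_one _))
  obtain ⟨z, hz, hmem⟩ := mem_nhdsGT_iff_exists_Ioc_subset.1 (h1.and h2)
  refine ⟨(‖Complex.Gamma (-(ν.re : ℂ))‖ + 1) / (‖Complex.Gamma (-ν)‖ / 2), z, hz,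
    fun y hy hyz => ?_⟩
  obtain ⟨a, b⟩ := hmem ⟨hy, hyz⟩
  rw [heatIntegral_ofReal, Complex.norm_real, Real.norm_of_nonneg (heatIntegralR_nonneg _ _ _)] at b
  rw [div_mul_eq_mul_div, le_div_iff₀ (by positivity)]
  exact mul_le_mul b.le a.le (by positivity) (by positivity)

lemma exists_norm_macdonaldK_le {ν : ℂ} (hν : ν.re ≠ 0 ∨ ν = 0) :
    ∃ C z₀ : ℝ, 0 < z₀ ∧ ∀ z, 0 < z → z ≤ z₀ →
      ‖macdonaldK ν.re z‖ ≤ C * ‖macdonaldK ν z‖ := by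
  have main : ∀ ν : ℂ, ν.re < 0 → ∃ C z₀ : ℝ, 0 < z₀ ∧ ∀ z, 0 < z → z ≤ z₀ →
      ‖macdonaldK ν.re z‖ ≤ C * ‖macdonaldK ν z‖ := by
    intro ν hν
    obtain ⟨C, z₀, hz₀, h⟩ := exists_heatIntegralR_le_of_re_neg hν
    refine ⟨C, z₀, hz₀, fun z hz hzz => ?_⟩
    have e1 := norm_macdonaldK_re (σ := ν.re) hz one_pos
    have e2 := norm_macdonaldK (ν := ν) hz one_pos
    rw [Real.one_rpow, one_mul, one_mul] at e1 e2
    rw [e1, e2]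
    have hp : 0 < 1 / 2 * (z / 2) ^ ν.re := by positivity
    calc _ ≤ 1 / 2 * (z / 2) ^ ν.re * (C * ‖heatIntegral 0 ν z 1‖) := by
          gcongr; exact h z hz hzz
      _ = _ := by ring
  rcases hν with hν | rfl
  · rcases lt_or_gt_of_ne hν with hν | hν
    · exact main ν hν
    · obtain ⟨C, z₀, hz₀, h⟩ := main (-ν) (by simpa using hν)
      refine ⟨C, z₀, hz₀, fun z hz hzz => ?_⟩
      have := h z hz hzz
      rw [Complex.neg_re, Complex.ofReal_neg, macdonaldK_neg, macdonaldK_neg] at this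
      exact this
  · exact ⟨1, 1, one_pos, fun z _ _ => by simp⟩

/-- Unless `ν` is purely imaginary and nonzero, `K_ν` has no zeros near the origin and its modulus
is there comparable with `K_{Re ν}`. -/
lemma exists_heatIntegralR_le {ν : ℂ} (hν : ν.re ≠ 0 ∨ ν = 0) :
    ∃ C z₀ : ℝ, 0 < z₀ ∧ ∀ y u, 0 < y → 0 < u → u * y ≤ z₀ →
      heatIntegralR ν.re y u ≤ C * ‖heatIntegral 0 ν y u‖ := by
  obtain ⟨C, z₀, hz₀, h⟩ := exists_norm_macdonaldK_le hν
  refine ⟨C, z₀, hz₀, fun y u hy hu huy => ?_⟩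
  have e1 := norm_macdonaldK_re (σ := ν.re) hy hu
  have e2 := norm_macdonaldK (ν := ν) hy hu
  have hp : 0 < 1 / 2 * (y / 2) ^ ν.re := by positivity
  refine le_of_mul_le_mul_left ?_ hp
  rw [← e1]
  calc _ ≤ u ^ ν.re * (C * ‖macdonaldK ν (u * y)‖) := by
        gcongr; exact h _ (mul_pos hu hy) huy
    _ = C * (u ^ ν.re * ‖macdonaldK ν (u * y)‖) := by ring
    _ = _ := by rw [e2]; ring

/-! ### Orders that are not purely imaginary -/

lemma norm_parsevalWeight (ν : ℂ) {y : ℝ} (hy : 0 < y) :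
    ‖parsevalWeight ν y‖ = 1 / 2 * (y / 2) ^ (2 * ν.re + 1) := by
  have h := congrArg norm (parsevalWeight_two_mul ν (y / 2))
  rw [norm_cpow_two_mul (by positivity), mul_div_cancel₀ y two_ne_zero, norm_mul,
    Complex.norm_two] at h
  rw [← h]
  ring

/-- Away from `u = 0`, `u ^ ν K_ν(u y)` decays at least like `u⁻²`. -/
lemma heatIntegralR_le_div_sq (σ : ℝ) {y u₀ u : ℝ} (hy : 0 < y) (hu₀ : 0 < u₀) (hu : u₀ ≤ u) :
    heatIntegralR σ y u ≤ 2 / u ^ 2 * heatIntegralR (σ + 1) y (u₀ / 2) := by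
  have hu' : 0 < u := hu₀.trans_le hu
  unfold heatIntegralR
  rw [← integral_const_mul]
  refine setIntegral_mono_on (integrableOn_heatKernelR σ hy hu')
    ((integrableOn_heatKernelR (σ + 1) hy (by positivity)).const_mul _) measurableSet_Ioi
    fun p hp => ?_
  have hp : 0 < p := hp
  unfold heatKernelR
  have e1 : p ^ (-σ - 1) = p ^ (-(σ + 1) - 1) * p := by
    rw [← Real.rpow_add_one hp.ne']
    ring_nf
  have e2 : u ^ 2 * p * Real.exp (-(u ^ 2 * p)) ≤ 2 * Real.exp (-((u₀ / 2) ^ 2 * p)) := by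
    have h1 := Real.add_one_le_exp (u ^ 2 * p / 2)
    have h2 : u ^ 2 * p ≤ 2 * Real.exp (u ^ 2 * p / 2) := by linarith
    calc u ^ 2 * p * Real.exp (-(u ^ 2 * p))
        ≤ 2 * Real.exp (u ^ 2 * p / 2) * Real.exp (-(u ^ 2 * p)) := by gcongr
      _ = 2 * Real.exp (-(u ^ 2 * p / 2)) := by
          rw [mul_assoc, ← Real.exp_add]; ring_nf
      _ ≤ _ := by
          gcongr
          have : u₀ ^ 2 ≤ u ^ 2 := by gcongr
          nlinarith
  have e3 : p * Real.exp (-(u ^ 2 * p)) ≤ 2 / u ^ 2 * Real.exp (-((u₀ / 2) ^ 2 * p)) := by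
    rw [div_mul_eq_mul_div, le_div_iff₀ (by positivity)]
    linarith
  rw [e1, sub_eq_add_neg (-(u ^ 2 * p)), sub_eq_add_neg (-((u₀ / 2) ^ 2 * p)), Real.exp_add,
    Real.exp_add]
  calc _ = p ^ (-(σ + 1) - 1) * Real.exp (-(y ^ 2 / (4 * p))) *
        (p * Real.exp (-(u ^ 2 * p))) := by ring
    _ ≤ p ^ (-(σ + 1) - 1) * Real.exp (-(y ^ 2 / (4 * p))) *
        (2 / u ^ 2 * Real.exp (-((u₀ / 2) ^ 2 * p))) := by gcongr
    _ = _ := by ring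

lemma heatIntegralR_anti (σ : ℝ) {y y' u : ℝ} (hy : 0 < y) (hyy : y ≤ y') (hu : 0 < u) :
    heatIntegralR σ y' u ≤ heatIntegralR σ y u := by
  unfold heatIntegralR
  refine setIntegral_mono_on (integrableOn_heatKernelR σ (hy.trans_le hyy) hu)
    (integrableOn_heatKernelR σ hy hu) measurableSet_Ioi fun p hp => ?_
  have hp : 0 < p := hp
  unfold heatKernelR
  gcongr

/-- Half of the exponent is spent on the decay in `y`, by `t² p + y² / (4 p) ≥ t y`. -/
lemma heatIntegralR_le_exp (σ : ℝ) {y y₀ t : ℝ} (hy₀ : 0 < y₀) (hy : y₀ ≤ y) (ht : 0 < t) :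
    heatIntegralR σ y t ≤ Real.exp (-(t * y / 2)) * heatIntegralR σ (y₀ / 2) (t / 2) := by
  unfold heatIntegralR
  rw [← integral_const_mul]
  refine setIntegral_mono_on (integrableOn_heatKernelR σ (hy₀.trans_le hy) ht)
    ((integrableOn_heatKernelR σ (by positivity) (by positivity)).const_mul _) measurableSet_Ioi
    fun p hp => ?_
  have hp : 0 < p := hp
  unfold heatKernelR
  rw [mul_left_comm, ← Real.exp_add]
  gcongr
  have h1 : t * y ≤ t ^ 2 * p + y ^ 2 / (4 * p) := by
    have h : t ^ 2 * p + y ^ 2 / (4 * p) - t * y = (2 * p * t - y) ^ 2 / (4 * p) := by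
      field_simp
      ring
    have h' : 0 ≤ (2 * p * t - y) ^ 2 / (4 * p) := by positivity
    linarith
  have h2 : (y₀ / 2) ^ 2 / (4 * p) ≤ y ^ 2 / (4 * p) / 2 := by
    have e : (y₀ / 2) ^ 2 / (4 * p) = y₀ ^ 2 / (4 * p) / 4 := by ring
    have h : y₀ ^ 2 / (4 * p) ≤ y ^ 2 / (4 * p) := by gcongr
    have h' : 0 ≤ y₀ ^ 2 / (4 * p) := by positivity
    linarith
  have h3 : (t / 2) ^ 2 * p ≤ t ^ 2 * p / 2 := by nlinarith [mul_pos (pow_pos ht 2) hp]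
  linarith

lemma integrableOn_parsevalWeight_mul_exp {ν : ℂ} (hν : -1 < ν.re) {a : ℝ} (ha : 0 < a) :
    IntegrableOn (fun y => ‖parsevalWeight ν y‖ * Real.exp (-(a * y))) (Ioi 0) := by
  have h := (integrableOn_rpow_mul_exp_neg_mul_rpow (s := 2 * ν.re + 1) (p := 1) (by linarith)
    one_pos ha).const_mul (1 / 2 * (1 / 2) ^ (2 * ν.re + 1))
  refine IntegrableOn.congr_fun h (fun y hy => ?_) measurableSet_Ioi
  have hy : 0 < y := hy
  rw [norm_parsevalWeight ν hy, div_eq_mul_one_div y, Real.mul_rpow hy.le (by norm_num),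
    Real.rpow_one]
  ring_nf

/-- Absolute convergence of the inner integral with `K_{Re ν}` in place of `K_ν`. -/
lemma integrableOn_heatIntegralR_mul {ν : ℂ} (hν : ν.re ≠ 0 ∨ ν = 0) {h : ℝ → ℂ}
    (hh : AEStronglyMeasurable h (volume.restrict (Ioi (0 : ℝ))))
    (hX : IntegrableOn (fun u => ‖h u‖ / (1 + u ^ 2)) (Ioi 0)) {y : ℝ} (hy : 0 < y)
    (hK : IntegrableOn (fun u => heatIntegral 0 ν y u * h u) (Ioi 0)) :
    IntegrableOn (fun u => heatIntegralR ν.re y u * ‖h u‖) (Ioi 0) := by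
  obtain ⟨C, z₀, hz₀, hC⟩ := exists_heatIntegralR_le hν
  let u₀ := z₀ / y
  have hu₀ : 0 < u₀ := by positivity
  let B := 2 * (1 / u₀ ^ 2 + 1) * heatIntegralR (ν.re + 1) y (u₀ / 2)
  have hB : 0 ≤ B := mul_nonneg (by positivity) (heatIntegralR_nonneg _ _ _)
  refine ((hK.norm.const_mul |C|).add (hX.const_mul B)).mono' ?_ ?_
  · exact AEStronglyMeasurable.mul (stronglyMeasurable_heatIntegralR ν.re measurable_const
      measurable_id).aestronglyMeasurable hh.norm
  · filter_upwards [ae_restrict_mem measurableSet_Ioi] with u hu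
    have hu : 0 < u := hu
    have hn := heatIntegralR_nonneg ν.re y u
    simp only [Pi.add_apply]
    rw [Real.norm_of_nonneg (by positivity), norm_mul]
    rcases le_total u u₀ with huu | huu
    · have h1 : heatIntegralR ν.re y u ≤ |C| * ‖heatIntegral 0 ν y u‖ :=
        (hC y u hy hu ((le_div_iff₀ hy).1 huu)).trans (by gcongr; exact le_abs_self C)
      calc _ ≤ |C| * ‖heatIntegral 0 ν y u‖ * ‖h u‖ := by gcongr
        _ = |C| * (‖heatIntegral 0 ν y u‖ * ‖h u‖) := by ring
        _ ≤ _ := le_add_of_nonneg_right (by positivity)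
    · have h1 := heatIntegralR_le_div_sq ν.re hy hu₀ huu
      have h2 : 2 / u ^ 2 ≤ 2 * (1 / u₀ ^ 2 + 1) / (1 + u ^ 2) := by
        have : u₀ ^ 2 ≤ u ^ 2 := by gcongr
        rw [div_le_div_iff₀ (by positivity) (by positivity)]
        have h3 : 1 ≤ 1 / u₀ ^ 2 * u ^ 2 := by
          rw [one_div_mul_eq_div, le_div_iff₀ (by positivity)]; linarith
        nlinarith
      have hn' := heatIntegralR_nonneg (ν.re + 1) y (u₀ / 2)
      calc _ ≤ 2 / u ^ 2 * heatIntegralR (ν.re + 1) y (u₀ / 2) * ‖h u‖ := by gcongr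
        _ ≤ 2 * (1 / u₀ ^ 2 + 1) / (1 + u ^ 2) * heatIntegralR (ν.re + 1) y (u₀ / 2) * ‖h u‖ := by
            gcongr
        _ = B * (‖h u‖ / (1 + u ^ 2)) := by simp only [B]; ring
        _ ≤ _ := le_add_of_nonneg_left (by positivity)

lemma integrableOn_majorant {ν : ℂ} (hν : ν.re ≠ 0 ∨ ν = 0) (hν1 : -1 < ν.re) {t : ℝ} (ht : 0 < t)
    {h : ℝ → ℂ} (hh : AEStronglyMeasurable h (volume.restrict (Ioi (0 : ℝ))))
    (hY : ∀ y : ℝ, 0 < y → IntegrableOn (fun u => heatIntegralR ν.re y u * ‖h u‖) (Ioi 0))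
    (hR : IntegrableOn (fun y : ℝ => parsevalWeight ν y * heatIntegral 0 ν y t *
      ∫ u in Ioi (0 : ℝ), heatIntegral 0 ν y u * h u) (Ioi 0)) :
    IntegrableOn (fun y : ℝ => ‖parsevalWeight ν y‖ * heatIntegralR ν.re y t *
      ‖∫ u in Ioi (0 : ℝ), heatIntegral 0 ν y u * h u‖) (Ioi 0) := by
  obtain ⟨C, z₀, hz₀, hC⟩ := exists_heatIntegralR_le hν
  let y₀ := z₀ / t
  have hy₀ : 0 < y₀ := by positivity
  let B := ∫ u in Ioi (0 : ℝ), heatIntegralR ν.re y₀ u * ‖h u‖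
  let A := heatIntegralR ν.re (y₀ / 2) (t / 2)
  have hB : 0 ≤ B := integral_nonneg fun u => mul_nonneg (heatIntegralR_nonneg _ _ _) (norm_nonneg _)
  have hA : 0 ≤ A := heatIntegralR_nonneg _ _ _
  have hE := integrableOn_parsevalWeight_mul_exp hν1 (a := t / 2) (by positivity)
  refine ((hR.norm.const_mul |C|).add (hE.const_mul (A * B))).mono' ?_ ?_
  · refine AEStronglyMeasurable.mul (AEStronglyMeasurable.mul ?_ ?_)
      (aestronglyMeasurable_integral_heatIntegral ν _ hh).norm
    · exact Measurable.aestronglyMeasurable (by fun_prop)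
    · exact (stronglyMeasurable_heatIntegralR ν.re measurable_id
        measurable_const).aestronglyMeasurable
  · filter_upwards [ae_restrict_mem measurableSet_Ioi] with y hy
    have hy : 0 < y := hy
    have hn := heatIntegralR_nonneg ν.re y t
    simp only [Pi.add_apply]
    rw [Real.norm_of_nonneg (by positivity), norm_mul, norm_mul]
    set Φ := ∫ u in Ioi (0 : ℝ), heatIntegral 0 ν y u * h u with hΦ
    rcases le_total y y₀ with hyy | hyy
    · have h1 : heatIntegralR ν.re y t ≤ |C| * ‖heatIntegral 0 ν y t‖ :=
        (hC y t hy ht (by rw [mul_comm]; exact (le_div_iff₀ ht).1 hyy)).trans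
          (by gcongr; exact le_abs_self C)
      calc _ ≤ ‖parsevalWeight ν y‖ * (|C| * ‖heatIntegral 0 ν y t‖) * ‖Φ‖ := by gcongr
        _ = |C| * (‖parsevalWeight ν y‖ * ‖heatIntegral 0 ν y t‖ * ‖Φ‖) := by ring
        _ ≤ _ := le_add_of_nonneg_right (by positivity)
    · have h1 : ‖Φ‖ ≤ B := by
        refine norm_integral_le_of_norm_le (hY y₀ hy₀) ?_
        filter_upwards [ae_restrict_mem measurableSet_Ioi] with u hu
        rw [norm_mul]
        gcongr
        exact (norm_heatIntegral_le le_rfl ν hy hu).trans (heatIntegralR_anti _ hy₀ hyy hu)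
      have h2 := heatIntegralR_le_exp ν.re hy₀ hyy ht
      calc _ ≤ ‖parsevalWeight ν y‖ * (Real.exp (-(t * y / 2)) * A) * B := by gcongr
        _ = A * B * (‖parsevalWeight ν y‖ * Real.exp (-(t / 2 * y))) := by ring_nf
        _ ≤ _ := le_add_of_nonneg_left (by positivity)

theorem integral_eq_of_re_ne_zero {ν : ℂ} (hν : ν.re ≠ 0 ∨ ν = 0) (hν1 : -1 < ν.re) {t : ℝ}
    (ht : 0 < t) {h : ℝ → ℂ} (hh : AEStronglyMeasurable h (volume.restrict (Ioi (0 : ℝ))))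
    (hX : ∀ x : ℝ, 0 < x → IntegrableOn (fun u => h u / ((u : ℂ) ^ 2 + (x : ℂ) ^ 2)) (Ioi 0))
    (hK : ∀ y : ℝ, 0 < y → IntegrableOn (fun u => heatIntegral 0 ν y u * h u) (Ioi 0))
    (hL : IntegrableOn (fun x : ℝ => (x : ℂ) * (x : ℂ) ^ (2 * ν) * ((1 / (x ^ 2 + t ^ 2) : ℝ) : ℂ) *
      ∫ u in Ioi (0 : ℝ), h u / ((u : ℂ) ^ 2 + (x : ℂ) ^ 2)) (Ioi 0))
    (hR : IntegrableOn (fun y : ℝ => parsevalWeight ν y * heatIntegral 0 ν y t *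
      ∫ u in Ioi (0 : ℝ), heatIntegral 0 ν y u * h u) (Ioi 0)) :
    ∫ x in Ioi (0 : ℝ), (x : ℂ) * (x : ℂ) ^ (2 * ν) * ((1 / (x ^ 2 + t ^ 2) : ℝ) : ℂ) *
        ∫ u in Ioi (0 : ℝ), h u / ((u : ℂ) ^ 2 + (x : ℂ) ^ 2) =
      ∫ y in Ioi (0 : ℝ), parsevalWeight ν y * heatIntegral 0 ν y t *
        ∫ u in Ioi (0 : ℝ), heatIntegral 0 ν y u * h u := by
  have hY : ∀ y : ℝ, 0 < y → IntegrableOn (fun u => heatIntegralR ν.re y u * ‖h u‖) (Ioi 0) :=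
    fun y hy => integrableOn_heatIntegralR_mul hν hh (integrable_norm_div_one_add_sq hX) hy
      (hK y hy)
  exact integral_eq_of_dominated ht hν1 hh hX hY hL (integrableOn_majorant hν hν1 ht hh hY hR)

/-! ### Purely imaginary orders -/

lemma norm_sinh_le_one {ν : ℂ} (hν : ν.re = 0) (s : ℝ) : ‖Complex.sinh (ν * s)‖ ≤ 1 := by
  have e : ν * s = ((ν.im * s : ℝ) : ℂ) * Complex.I := by
    apply Complex.ext <;> simp [hν]
  rw [e, Complex.sinh_mul_I, norm_mul, Complex.norm_I, mul_one, ← Complex.ofReal_sin,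
    Complex.norm_real]
  exact Real.abs_sin_le_one _

lemma tendsto_exp_neg_cosh {z : ℝ} (hz : 0 < z) :
    Filter.Tendsto (fun s => Real.exp (-z * Real.cosh s)) Filter.atTop (nhds 0) := by
  refine Real.tendsto_exp_atBot.comp ?_
  refine Filter.Tendsto.const_mul_atTop_of_neg (by linarith) ?_
  refine Filter.tendsto_atTop_mono (fun s => ?_) (Real.tendsto_exp_atTop.const_mul_atTop
    (by norm_num : (0 : ℝ) < 1 / 2))
  rw [Real.cosh_eq]
  have := Real.exp_pos (-s)
  linarith

/-- Integration by parts against the oscillating factor removes the logarithmic growth of `K_ν` at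
the origin. -/
lemma norm_macdonaldK_le_exp {ν : ℂ} (hν : ν.re = 0) (hν0 : ν ≠ 0) {z : ℝ} (hz : 0 < z) :
    ‖macdonaldK ν z‖ ≤ Real.exp (-z) / ‖ν‖ := by
  have hd : ∀ s : ℝ, HasDerivAt (fun s => -Real.exp (-z * Real.cosh s))
      (z * Real.sinh s * Real.exp (-z * Real.cosh s)) s := by
    intro s
    convert! (((Real.hasDerivAt_cosh s).const_mul (-z)).exp).neg using 1
    ring
  have hlim : Filter.Tendsto (fun s => -Real.exp (-z * Real.cosh s)) Filter.atTop (nhds 0) := by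
    simpa using (tendsto_exp_neg_cosh hz).neg
  have hpos : ∀ s ∈ Ioi (0 : ℝ), 0 ≤ z * Real.sinh s * Real.exp (-z * Real.cosh s) := by
    intro s hs
    have := Real.sinh_nonneg_iff.2 (le_of_lt hs)
    positivity
  have hI1 := integrableOn_Ioi_deriv_of_nonneg' (fun s _ => hd s) hpos hlim
  have hV1 := integral_Ioi_of_hasDerivAt_of_nonneg' (fun s _ => hd s) hpos hlim
  have hI2 : IntegrableOn (fun s : ℝ => (Real.exp (-z * Real.cosh s) : ℂ) *
      Complex.cosh (ν * s)) (Ioi 0) := by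
    have h1 := (integrable_exp_cosh_mul_exp ν hz).integrableOn (s := Ioi 0)
    have h2 := (integrable_exp_cosh_mul_exp (-ν) hz).integrableOn (s := Ioi 0)
    refine IntegrableOn.congr_fun ((h1.add h2).const_mul (1 / 2)) (fun s _ => ?_) measurableSet_Ioi
    simp only [Complex.cosh, Pi.add_apply, neg_mul, neg_neg]
    ring
  have hI3 : IntegrableOn (fun s : ℝ => ((z * Real.sinh s * Real.exp (-z * Real.cosh s) : ℝ) : ℂ) *
      Complex.sinh (ν * s)) (Ioi 0) := by
    refine hI1.mono' (by fun_prop) ?_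
    filter_upwards [ae_restrict_mem measurableSet_Ioi] with s hs
    rw [norm_mul, Complex.norm_real, Real.norm_of_nonneg (hpos s hs)]
    exact mul_le_of_le_one_right (hpos s hs) (norm_sinh_le_one hν s)
  have hd2 : ∀ s : ℝ, HasDerivAt
      (fun s : ℝ => (Real.exp (-z * Real.cosh s) : ℂ) * Complex.sinh (ν * s))
      (ν * ((Real.exp (-z * Real.cosh s) : ℂ) * Complex.cosh (ν * s)) -
        ((z * Real.sinh s * Real.exp (-z * Real.cosh s) : ℝ) : ℂ) * Complex.sinh (ν * s)) s := by
    intro s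
    have h1 : HasDerivAt (fun s : ℝ => (Real.exp (-z * Real.cosh s) : ℂ))
        ((-(z * Real.sinh s * Real.exp (-z * Real.cosh s)) : ℝ) : ℂ) s := by
      have := (hd s).neg.ofReal_comp
      simpa using this
    have h2 : HasDerivAt (fun s : ℝ => Complex.sinh (ν * s)) (Complex.cosh (ν * s) * ν) s := by
      have := (Complex.hasDerivAt_sinh (ν * s)).comp s
        (((hasDerivAt_id (s : ℂ)).const_mul ν).comp_ofReal)
      simpa [Function.comp_def] using this
    convert! h1.mul h2 using 1
    push_cast
    ring
  have hlim2 : Filter.Tendsto (fun s : ℝ => (Real.exp (-z * Real.cosh s) : ℂ) *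
      Complex.sinh (ν * s)) Filter.atTop (nhds 0) := by
    refine squeeze_zero_norm (fun s => ?_) (tendsto_exp_neg_cosh hz)
    rw [norm_mul, Complex.norm_real, Real.norm_of_nonneg (Real.exp_pos _).le]
    exact mul_le_of_le_one_right (Real.exp_pos _).le (norm_sinh_le_one hν s)
  have hV2 := integral_Ioi_of_hasDerivAt_of_tendsto' (a := 0) (fun s _ => hd2 s)
    ((hI2.const_mul ν).sub hI3) hlim2
  rw [integral_sub (hI2.const_mul ν) hI3, integral_const_mul] at hV2
  change ν * macdonaldK ν z - _ = _ at hV2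
  have hb : ‖ν * macdonaldK ν z‖ ≤ Real.exp (-z) := by
    have e : ν * macdonaldK ν z = ∫ s in Ioi (0 : ℝ),
        ((z * Real.sinh s * Real.exp (-z * Real.cosh s) : ℝ) : ℂ) * Complex.sinh (ν * s) := by
      have : Complex.sinh (ν * ((0 : ℝ) : ℂ)) = 0 := by simp
      rw [this, mul_zero, sub_zero] at hV2
      exact sub_eq_zero.1 hV2
    rw [e]
    have h1 : (0 : ℝ) - -Real.exp (-z * Real.cosh 0) = Real.exp (-z) := by simp
    rw [← h1, ← hV1]
    refine norm_integral_le_of_norm_le hI1 ?_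
    filter_upwards [ae_restrict_mem measurableSet_Ioi] with s hs
    rw [norm_mul, Complex.norm_real, Real.norm_of_nonneg (hpos s hs)]
    exact mul_le_of_le_one_right (hpos s hs) (norm_sinh_le_one hν s)
  rw [norm_mul] at hb
  rw [le_div_iff₀ (norm_pos_iff.2 hν0), mul_comm]
  exact hb

lemma norm_parsevalWeight_mul_le {ν : ℂ} (hν : ν.re = 0) (hν0 : ν ≠ 0) {y t u : ℝ} (hy : 0 < y)
    (ht : 0 < t) (hu : 0 < u) :
    ‖parsevalWeight ν y * heatIntegral 0 ν y t * heatIntegral 0 ν y u‖ ≤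
      y * Real.exp (-((t + u) * y)) / ‖ν‖ ^ 2 := by
  have e : parsevalWeight ν y * heatIntegral 0 ν y t * heatIntegral 0 ν y u =
      y * ((t : ℂ) ^ ν * macdonaldK ν (t * y)) * ((u : ℂ) ^ ν * macdonaldK ν (u * y)) := by
    rw [cpow_mul_macdonaldK ν hy ht, cpow_mul_macdonaldK ν hy hu, parsevalWeight]
    ring
  have hk : ∀ {v : ℝ}, 0 < v → ‖(v : ℂ) ^ ν * macdonaldK ν (v * y)‖ ≤
      Real.exp (-(v * y)) / ‖ν‖ := by
    intro v hv
    rw [norm_mul, Complex.norm_cpow_eq_rpow_re_of_pos hv, hν, Real.rpow_zero, one_mul]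
    exact norm_macdonaldK_le_exp hν hν0 (mul_pos hv hy)
  rw [e, norm_mul, norm_mul, Complex.norm_real, Real.norm_of_nonneg hy.le]
  calc _ ≤ y * (Real.exp (-(t * y)) / ‖ν‖) * (Real.exp (-(u * y)) / ‖ν‖) := by
        gcongr
        · exact hk ht
        · exact hk hu
    _ = y * (Real.exp (-(t * y)) * Real.exp (-(u * y))) / ‖ν‖ ^ 2 := by ring
    _ = _ := by rw [← Real.exp_add]; ring_nf

lemma one_add_sq_le {a c u : ℝ} (ha : 0 < a) (h1 : a ≤ c) (h2 : u ^ 2 ≤ c) :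
    1 + u ^ 2 ≤ (1 + 1 / a) * c := by
  have h3 : 1 ≤ 1 / a * c := by rw [one_div_mul_eq_div, le_div_iff₀ ha]; linarith
  nlinarith

lemma integral_mul_exp_neg {c : ℝ} (hc : 0 < c) :
    ∫ y in Ioi (0 : ℝ), y * Real.exp (-(c * y)) = 1 / c ^ 2 := by
  have h := Real.integral_rpow_mul_exp_neg_mul_Ioi (a := 2) two_pos hc
  rw [Real.Gamma_two, mul_one, show (2 : ℝ) - 1 = 1 by norm_num] at h
  simpa using h

lemma integrableOn_mul_exp_neg {c : ℝ} (hc : 0 < c) :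
    IntegrableOn (fun y : ℝ => y * Real.exp (-(c * y))) (Ioi 0) := by
  have h := integrableOn_rpow_mul_exp_neg_mul_rpow (s := 1) (p := 1) (by norm_num) one_pos hc
  simpa using h

/-- On the Macdonald side the order of integration can be exchanged directly. -/
lemma integral_macdonald_swap {ν : ℂ} (hν : ν.re = 0) (hν0 : ν ≠ 0) {t : ℝ} (ht : 0 < t)
    {h : ℝ → ℂ} (hh : AEStronglyMeasurable h (volume.restrict (Ioi (0 : ℝ))))
    (hX : IntegrableOn (fun u => ‖h u‖ / (1 + u ^ 2)) (Ioi 0)) :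
    ∫ y in Ioi (0 : ℝ), parsevalWeight ν y * heatIntegral 0 ν y t *
        ∫ u in Ioi (0 : ℝ), heatIntegral 0 ν y u * h u =
      ∫ u in Ioi (0 : ℝ), (∫ y in Ioi (0 : ℝ),
        parsevalWeight ν y * heatIntegral 0 ν y t * heatIntegral 0 ν y u) * h u := by
  simp only [← integral_const_mul, ← integral_mul_const, ← mul_assoc]
  refine integral_integral_swap ?_
  have hB : Integrable (fun z : ℝ × ℝ => z.1 * Real.exp (-((t + z.2) * z.1)) / ‖ν‖ ^ 2 * ‖h z.2‖)
      ((volume.restrict (Ioi (0 : ℝ))).prod (volume.restrict (Ioi (0 : ℝ)))) := by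
    have hm : AEStronglyMeasurable
        (fun z : ℝ × ℝ => z.1 * Real.exp (-((t + z.2) * z.1)) / ‖ν‖ ^ 2 * ‖h z.2‖)
        ((volume.restrict (Ioi (0 : ℝ))).prod (volume.restrict (Ioi (0 : ℝ)))) :=
      AEStronglyMeasurable.mul (Measurable.aestronglyMeasurable (by fun_prop)) hh.norm.comp_snd
    rw [integrable_prod_iff' hm]
    constructor
    · filter_upwards [ae_restrict_mem measurableSet_Ioi] with u hu
      have hu : 0 < u := hu
      exact ((integrableOn_mul_exp_neg (by linarith : 0 < t + u)).div_const _).mul_const ‖h u‖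
    · have hm2 := hm.norm.prod_swap.integral_prod_right'
      refine (hX.const_mul ((1 + 1 / t ^ 2) / ‖ν‖ ^ 2)).mono' hm2 ?_
      filter_upwards [ae_restrict_mem measurableSet_Ioi] with u hu
      have hu : 0 < u := hu
      have e : ∫ y in Ioi (0 : ℝ), ‖y * Real.exp (-((t + u) * y)) / ‖ν‖ ^ 2 * ‖h u‖‖ =
          1 / (t + u) ^ 2 / ‖ν‖ ^ 2 * ‖h u‖ := by
        rw [← integral_mul_exp_neg (by linarith : 0 < t + u), ← integral_div, ← integral_mul_const]
        refine setIntegral_congr_fun measurableSet_Ioi fun y hy => ?_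
        have hy : 0 < y := hy
        exact Real.norm_of_nonneg (by positivity)
      rw [e, Real.norm_of_nonneg (by positivity)]
      have h1 : 1 / (t + u) ^ 2 ≤ (1 + 1 / t ^ 2) / (1 + u ^ 2) := by
        rw [div_le_div_iff₀ (by positivity) (by positivity), one_mul]
        exact one_add_sq_le (by positivity) (by nlinarith) (by nlinarith)
      calc _ ≤ (1 + 1 / t ^ 2) / (1 + u ^ 2) / ‖ν‖ ^ 2 * ‖h u‖ := by gcongr
        _ = _ := by ring
  refine hB.mono' ?_ ?_
  · unfold Function.uncurry
    refine AEStronglyMeasurable.mul (AEStronglyMeasurable.mul (AEStronglyMeasurable.mul ?_ ?_) ?_)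
      hh.comp_snd
    · exact Measurable.aestronglyMeasurable (by fun_prop)
    · exact (stronglyMeasurable_heatIntegral 0 ν measurable_fst
        measurable_const).aestronglyMeasurable
    · exact (stronglyMeasurable_heatIntegral 0 ν measurable_fst
        measurable_snd).aestronglyMeasurable
  · have e1 := Measure.quasiMeasurePreserving_fst (μ := volume.restrict (Ioi (0 : ℝ)))
      (ν := volume.restrict (Ioi (0 : ℝ)))
    have e2 := Measure.quasiMeasurePreserving_snd (μ := volume.restrict (Ioi (0 : ℝ)))
      (ν := volume.restrict (Ioi (0 : ℝ)))
    filter_upwards [e1.ae (ae_restrict_mem measurableSet_Ioi),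
      e2.ae (ae_restrict_mem measurableSet_Ioi)] with z h1 h2
    simp only [Function.uncurry]
    rw [norm_mul]
    gcongr
    exact norm_parsevalWeight_mul_le hν hν0 h1 ht h2

/-- The kernels of the two sides agree: the regularised identity for a point mass at `u`. -/
lemma integral_kernel_eq {ν : ℂ} (hν : ν.re = 0) {t u : ℝ} (ht : 0 < t) (hu : 0 < u) :
    ∫ x in Ioi (0 : ℝ), (x : ℂ) * (x : ℂ) ^ (2 * ν) * ((1 / (x ^ 2 + t ^ 2) : ℝ) : ℂ) *
        (1 / ((u : ℂ) ^ 2 + (x : ℂ) ^ 2)) =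
      ∫ y in Ioi (0 : ℝ), parsevalWeight ν y * heatIntegral 0 ν y t * heatIntegral 0 ν y u := by
  have hu' : ∀ᵐ v ∂(Measure.dirac u), v = u := by
    rw [ae_dirac_eq]
    exact rfl
  have hμ : ∀ᵐ v ∂(Measure.dirac u), 0 < v := by
    filter_upwards [hu'] with v hv
    rwa [hv]
  have hs : ∀ {v : ℝ}, 0 < v → IntegrableOn
      (fun p : ℝ => p ^ (-1 / 2 : ℝ) * Real.exp (-(v ^ 2 * p))) (Ioi 0) := by
    intro v hv
    have h := integrableOn_rpow_mul_exp_neg_mul_rpow (s := -1 / 2) (p := 1) (by norm_num) one_pos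
      (pow_pos hv 2)
    simpa using h
  have hD : Integrable (heatDensity ν.re t fun _ => 1) ((volume.restrict (Ioi (0 : ℝ))).prod
      ((Measure.dirac u).prod (volume.restrict (Ioi (0 : ℝ))))) := by
    refine ((hs ht).mul_prod ((hs hu).comp_snd (Measure.dirac u))).mono' ?_ ?_
    · unfold heatDensity
      exact Measurable.aestronglyMeasurable (by fun_prop)
    · have e2 := Measure.quasiMeasurePreserving_snd (μ := volume.restrict (Ioi (0 : ℝ)))
        (ν := (Measure.dirac u).prod (volume.restrict (Ioi (0 : ℝ))))
      have e3 := Measure.quasiMeasurePreserving_fst (μ := Measure.dirac u)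
        (ν := volume.restrict (Ioi (0 : ℝ)))
      filter_upwards [ae_restrict_prod_pos hμ le_rfl, e2.ae (e3.ae hu')] with s hs hsu
      obtain ⟨h1, h2, h3⟩ := hs
      have hs0 : 0 < s.1 + s.2.2 := by linarith
      simp only [heatDensity]
      rw [Real.norm_of_nonneg (by positivity), hν, hsu, norm_one, mul_one, sub_eq_add_neg (-(s.1 * t ^ 2)),
        Real.exp_add]
      -- `√p √q ≤ p + q`
      have h4 : (s.1 + s.2.2) ^ (-0 - 1 : ℝ) ≤ s.1 ^ (-1 / 2 : ℝ) * s.2.2 ^ (-1 / 2 : ℝ) := by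
        rw [show (-0 - 1 : ℝ) = -1 / 2 + -1 / 2 by norm_num, Real.rpow_add hs0]
        gcongr ?_ * ?_
        · exact Real.rpow_le_rpow_of_nonpos h1 (by linarith) (by norm_num)
        · exact Real.rpow_le_rpow_of_nonpos h3 (by linarith) (by norm_num)
      calc _ ≤ s.1 ^ (-1 / 2 : ℝ) * s.2.2 ^ (-1 / 2 : ℝ) *
            (Real.exp (-(s.1 * t ^ 2)) * Real.exp (-(s.2.2 * u ^ 2))) := by gcongr
        _ = _ := by ring_nf
  have h := integral_regularized_eq hμ le_rfl ht (by rw [hν]; norm_num)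
    aestronglyMeasurable_const hD (fun x _ => integrable_dirac (by simp))
    (fun y _ => integrable_dirac (by simp))
  simpa using h

/-- The smooth factor `x² / ((x² + t²) (x² + u²))` that multiplies `x ^ (2 ν - 1)`. -/
def widderFactor (t u x : ℝ) : ℝ := x ^ 2 / ((x ^ 2 + t ^ 2) * (x ^ 2 + u ^ 2))

/-- The derivative of `widderFactor t u`. -/
def widderFactorDeriv (t u x : ℝ) : ℝ :=
  2 * x * (t ^ 2 * u ^ 2 - x ^ 4) / ((x ^ 2 + t ^ 2) * (x ^ 2 + u ^ 2)) ^ 2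

lemma widderFactor_comm (t u x : ℝ) : widderFactor t u x = widderFactor u t x := by
  unfold widderFactor; ring

lemma hasDerivAt_widderFactor {t u : ℝ} (ht : 0 < t) (hu : 0 < u) (x : ℝ) :
    HasDerivAt (widderFactor t u) (widderFactorDeriv t u x) x := by
  have h1 : HasDerivAt (fun x : ℝ => x ^ 2) (2 * x) x := by simpa using hasDerivAt_pow 2 x
  have h := h1.div ((h1.add_const (t ^ 2)).mul (h1.add_const (u ^ 2)))
    (by simp only [Pi.mul_apply]; positivity)
  convert! h using 1
  simp only [widderFactorDeriv, Pi.mul_apply]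
  congr 1
  ring

lemma continuous_widderFactorDeriv {t u : ℝ} (ht : 0 < t) (hu : 0 < u) :
    Continuous (widderFactorDeriv t u) := by
  unfold widderFactorDeriv
  refine Continuous.div (by fun_prop) (by fun_prop) fun x => ?_
  positivity

lemma widderFactor_nonneg (t u x : ℝ) : 0 ≤ widderFactor t u x := by
  unfold widderFactor; positivity

lemma widderFactor_le {t u : ℝ} (ht : 0 < t) (hu : 0 < u) (x : ℝ) :
    widderFactor t u x ≤ 1 / u ^ 2 := by
  unfold widderFactor
  rw [div_le_div_iff₀ (by positivity) (by positivity)]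
  have h1 : 0 ≤ x ^ 2 * x ^ 2 := by positivity
  have h2 : 0 ≤ t ^ 2 * x ^ 2 := by positivity
  have h3 : 0 ≤ t ^ 2 * u ^ 2 := by positivity
  nlinarith

lemma integral_abs_widderFactorDeriv_le {t u a b : ℝ} (ht : 0 < t) (hu : 0 < u) (ha : 0 < a)
    (hab : a ≤ b) : ∫ x in a..b, |widderFactorDeriv t u x| ≤ 2 / u ^ 2 := by
  -- `-N` is a primitive of a majorant of the absolute value.
  let N : ℝ → ℝ := fun x => 1 / (x ^ 2 + u ^ 2) + t ^ 2 / u ^ 2 * (1 / (x ^ 2 + t ^ 2))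
  let N' : ℝ → ℝ := fun x =>
    2 * x / (x ^ 2 + u ^ 2) ^ 2 + t ^ 2 / u ^ 2 * (2 * x / (x ^ 2 + t ^ 2) ^ 2)
  have hd : ∀ (v : ℝ), 0 < v → ∀ x : ℝ,
      HasDerivAt (fun x : ℝ => 1 / (x ^ 2 + v ^ 2)) (-(2 * x / (x ^ 2 + v ^ 2) ^ 2)) x := by
    intro v hv x
    have h1 : HasDerivAt (fun x : ℝ => x ^ 2 + v ^ 2) (2 * x) x := by
      simpa using (hasDerivAt_pow 2 x).add_const (v ^ 2)
    have h := h1.inv (by positivity : x ^ 2 + v ^ 2 ≠ 0)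
    convert! h using 1
    · ext x; simp
    · ring
  have hN : ∀ x : ℝ, HasDerivAt (fun x => -N x) (N' x) x := by
    intro x
    convert! ((hd u hu x).add ((hd t ht x).const_mul (t ^ 2 / u ^ 2))).neg using 1
    simp only [N']
    ring
  have hc : Continuous N' := by
    simp only [N']
    refine Continuous.add (Continuous.div (by fun_prop) (by fun_prop) fun x => ?_)
      (Continuous.mul continuous_const (Continuous.div (by fun_prop) (by fun_prop) fun x => ?_))
    · positivity
    · positivity
  have hle : ∀ x ∈ Icc a b, |widderFactorDeriv t u x| ≤ N' x := by
    intro x hx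
    have hx : 0 < x := ha.trans_le hx.1
    unfold widderFactorDeriv
    have hxt : 0 < x ^ 2 + t ^ 2 := by positivity
    have hxu : 0 < x ^ 2 + u ^ 2 := by positivity
    rw [abs_div, abs_of_pos (by positivity : 0 < ((x ^ 2 + t ^ 2) * (x ^ 2 + u ^ 2)) ^ 2), abs_mul,
      abs_of_pos (by positivity : 0 < 2 * x)]
    have h1 : |t ^ 2 * u ^ 2 - x ^ 4| ≤ t ^ 2 * u ^ 2 + x ^ 4 := by
      rw [abs_le]
      have h2 : 0 ≤ t ^ 2 * u ^ 2 := by positivity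
      have h3 : 0 ≤ x ^ 4 := by positivity
      constructor <;> linarith
    have h2 : x ^ 4 / ((x ^ 2 + t ^ 2) * (x ^ 2 + u ^ 2)) ^ 2 ≤ 1 / (x ^ 2 + u ^ 2) ^ 2 := by
      rw [div_le_div_iff₀ (by positivity) (by positivity), one_mul, mul_pow]
      gcongr
      nlinarith [mul_pos (pow_pos hx 2) (pow_pos ht 2), pow_pos ht 4]
    have h3 : t ^ 2 * u ^ 2 / ((x ^ 2 + t ^ 2) * (x ^ 2 + u ^ 2)) ^ 2 ≤
        t ^ 2 / u ^ 2 * (1 / (x ^ 2 + t ^ 2) ^ 2) := by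
      rw [div_mul_div_comm, mul_one, div_le_div_iff₀ (by positivity) (by positivity), mul_pow]
      have h4 : u ^ 2 * u ^ 2 ≤ (x ^ 2 + u ^ 2) ^ 2 := by
        nlinarith [mul_pos (pow_pos hx 2) (pow_pos hu 2), pow_pos hx 4]
      calc t ^ 2 * u ^ 2 * (u ^ 2 * (x ^ 2 + t ^ 2) ^ 2)
          = t ^ 2 * (x ^ 2 + t ^ 2) ^ 2 * (u ^ 2 * u ^ 2) := by ring
        _ ≤ t ^ 2 * (x ^ 2 + t ^ 2) ^ 2 * (x ^ 2 + u ^ 2) ^ 2 := by gcongr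
        _ = _ := by ring
    calc _ ≤ 2 * x * (t ^ 2 * u ^ 2 + x ^ 4) / ((x ^ 2 + t ^ 2) * (x ^ 2 + u ^ 2)) ^ 2 := by gcongr
      _ = 2 * x * (x ^ 4 / ((x ^ 2 + t ^ 2) * (x ^ 2 + u ^ 2)) ^ 2 +
          t ^ 2 * u ^ 2 / ((x ^ 2 + t ^ 2) * (x ^ 2 + u ^ 2)) ^ 2) := by ring
      _ ≤ 2 * x * (1 / (x ^ 2 + u ^ 2) ^ 2 + t ^ 2 / u ^ 2 * (1 / (x ^ 2 + t ^ 2) ^ 2)) := by gcongr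
      _ = _ := by simp only [N']; ring
  calc _ ≤ ∫ x in a..b, N' x := intervalIntegral.integral_mono_on hab
        ((continuous_widderFactorDeriv ht hu).abs.intervalIntegrable _ _)
        (hc.intervalIntegrable _ _) hle
    _ = -N b - -N a := intervalIntegral.integral_eq_sub_of_hasDerivAt (fun x _ => hN x)
        (hc.intervalIntegrable _ _)
    _ ≤ N a := by
        have : 0 ≤ N b := by simp only [N]; positivity
        linarith
    _ ≤ 1 / u ^ 2 + t ^ 2 / u ^ 2 * (1 / t ^ 2) := by
        simp only [N]
        have := sq_nonneg a
        gcongr <;> linarith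
    _ = 2 / u ^ 2 := by field_simp; norm_num

/-- Integration by parts with the primitive `x ^ (2 ν) / (2 ν)`, which is bounded for purely
imaginary `ν`. -/
lemma norm_integral_widderFactor_le {ν : ℂ} (hν : ν.re = 0) (hν0 : ν ≠ 0) {t u a b : ℝ}
    (ht : 0 < t) (hu : 0 < u) (ha : 0 < a) (hab : a ≤ b) :
    ‖∫ x in a..b, (widderFactor t u x : ℂ) * (x : ℂ) ^ (2 * ν - 1)‖ ≤ 2 / ‖ν‖ * (1 / u ^ 2) := by
  let V : ℝ → ℂ := fun x => (x : ℂ) ^ (2 * ν) / (2 * ν)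
  have hVn : ∀ x, 0 < x → ‖V x‖ = 1 / (2 * ‖ν‖) := by
    intro x hx
    simp only [V]
    rw [norm_div, Complex.norm_cpow_eq_rpow_re_of_pos hx, norm_mul, Complex.norm_two]
    simp [hν]
  have hpos : ∀ x ∈ uIcc a b, 0 < x := by
    intro x hx
    rw [uIcc_of_le hab] at hx
    exact ha.trans_le hx.1
  have hV : ∀ x ∈ uIcc a b, HasDerivAt V ((x : ℂ) ^ (2 * ν - 1)) x := by
    intro x hx
    have hne : 2 * ν - 1 ≠ -1 := by
      intro h
      apply hν0
      linear_combination (1 / 2) * h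
    have h := hasDerivAt_ofReal_cpow_const' (hpos x hx).ne' hne
    simpa [V] using h
  have hF : ∀ x ∈ uIcc a b, HasDerivAt (fun x => (widderFactor t u x : ℂ))
      (widderFactorDeriv t u x : ℂ) x :=
    fun x _ => (hasDerivAt_widderFactor ht hu x).ofReal_comp
  have hcD := continuous_widderFactorDeriv ht hu
  have hcP : ContinuousOn (fun x : ℝ => (x : ℂ) ^ (2 * ν - 1)) (uIcc a b) := by
    intro x hx
    refine ContinuousAt.continuousWithinAt ?_
    exact Complex.continuousAt_ofReal_cpow_const _ _ (Or.inr (hpos x hx).ne')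
  rw [intervalIntegral.integral_mul_deriv_eq_deriv_mul hF hV
    ((Complex.continuous_ofReal.comp hcD).intervalIntegrable _ _) hcP.intervalIntegrable]
  have hK : 0 ≤ 1 / (2 * ‖ν‖) := by positivity
  have hend : ∀ x, 0 < x → ‖(widderFactor t u x : ℂ) * V x‖ ≤ 1 / u ^ 2 * (1 / (2 * ‖ν‖)) := by
    intro x hx
    rw [norm_mul, hVn x hx, Complex.norm_real, Real.norm_of_nonneg (widderFactor_nonneg _ _ _)]
    gcongr
    exact widderFactor_le ht hu x
  have hint : ‖∫ x in a..b, (widderFactorDeriv t u x : ℂ) * V x‖ ≤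
      2 / u ^ 2 * (1 / (2 * ‖ν‖)) := by
    calc _ ≤ ∫ x in a..b, |widderFactorDeriv t u x| * (1 / (2 * ‖ν‖)) := by
          refine intervalIntegral.norm_integral_le_of_norm_le hab
            (Filter.Eventually.of_forall fun x hx => ?_)
            ((hcD.abs.mul continuous_const).intervalIntegrable _ _)
          rw [norm_mul, hVn x (ha.trans hx.1), Complex.norm_real, Real.norm_eq_abs]
      _ ≤ _ := by
          rw [intervalIntegral.integral_mul_const]
          gcongr
          exact integral_abs_widderFactorDeriv_le ht hu ha hab
  calc _ ≤ 1 / u ^ 2 * (1 / (2 * ‖ν‖)) + 1 / u ^ 2 * (1 / (2 * ‖ν‖)) +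
        2 / u ^ 2 * (1 / (2 * ‖ν‖)) :=
        (norm_sub_le _ _).trans (add_le_add ((norm_sub_le _ _).trans
          (add_le_add (hend b (ha.trans_le hab)) (hend a ha))) hint)
    _ = _ := by
        have : ‖ν‖ ≠ 0 := norm_ne_zero_iff.2 hν0
        field_simp
        norm_num

lemma widder_integrand_eq {ν : ℂ} {t u x : ℝ} (hx : 0 < x) :
    (x : ℂ) * (x : ℂ) ^ (2 * ν) * ((1 / (x ^ 2 + t ^ 2) : ℝ) : ℂ) *
      (1 / ((u : ℂ) ^ 2 + (x : ℂ) ^ 2)) = (widderFactor t u x : ℂ) * (x : ℂ) ^ (2 * ν - 1) := by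
  have hx0 : (x : ℂ) ≠ 0 := by exact_mod_cast hx.ne'
  rw [Complex.cpow_sub _ _ hx0, Complex.cpow_one]
  unfold widderFactor
  push_cast
  rw [div_eq_mul_inv, div_eq_mul_inv, div_eq_mul_inv, div_eq_mul_inv, mul_inv, one_mul, one_mul,
    add_comm ((u : ℂ) ^ 2)]
  field_simp

lemma integrableOn_widder_kernel {ν : ℂ} (hν : ν.re = 0) {t u : ℝ} (ht : 0 < t) (hu : 0 < u) :
    IntegrableOn (fun x : ℝ => (x : ℂ) * (x : ℂ) ^ (2 * ν) * ((1 / (x ^ 2 + t ^ 2) : ℝ) : ℂ) *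
      (1 / ((u : ℂ) ^ 2 + (x : ℂ) ^ 2))) (Ioi 0) := by
  have hI := (integrable_inv_one_add_sq.integrableOn (s := Ioi (0 : ℝ))).const_mul
    (1 / (2 * t) * (1 + 1 / u ^ 2))
  refine hI.mono' (Measurable.aestronglyMeasurable (by fun_prop)) ?_
  filter_upwards [ae_restrict_mem measurableSet_Ioi] with x hx
  have hx : 0 < x := hx
  rw [norm_mul, norm_mul, norm_cpow_two_mul hx, hν, Complex.norm_real,
    Real.norm_of_nonneg (by positivity),
    show (1 / ((u : ℂ) ^ 2 + (x : ℂ) ^ 2)) = ((1 / (u ^ 2 + x ^ 2) : ℝ) : ℂ) by push_cast; rfl,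
    Complex.norm_real, Real.norm_of_nonneg (by positivity), mul_zero, zero_add, Real.rpow_one]
  have h1 : x * (1 / (x ^ 2 + t ^ 2)) ≤ 1 / (2 * t) := by
    rw [mul_one_div, div_le_div_iff₀ (by positivity) (by positivity)]
    nlinarith [sq_nonneg (x - t)]
  have h2 : 1 / (u ^ 2 + x ^ 2) ≤ (1 + 1 / u ^ 2) * (1 + x ^ 2)⁻¹ := by
    rw [← div_eq_mul_inv, div_le_div_iff₀ (by positivity) (by positivity), one_mul]
    exact one_add_sq_le (by positivity) (by nlinarith) (by nlinarith)
  calc _ ≤ 1 / (2 * t) * ((1 + 1 / u ^ 2) * (1 + x ^ 2)⁻¹) := by gcongr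
    _ = _ := by ring

lemma iUnion_Ioc_one_div : ⋃ n : ℕ, Ioc (1 / ((n : ℝ) + 1)) ((n : ℝ) + 1) = Ioi (0 : ℝ) := by
  ext p
  simp only [mem_iUnion, mem_Ioi, mem_Ioc]
  constructor
  · rintro ⟨n, hn, -⟩
    exact lt_trans (by positivity) hn
  · intro hp
    obtain ⟨m, hm⟩ := exists_nat_one_div_lt hp
    obtain ⟨k, hk⟩ := exists_nat_gt p
    refine ⟨max m k, lt_of_le_of_lt (Nat.one_div_le_one_div (le_max_left m k)) hm, ?_⟩
    have : (k : ℝ) ≤ (max m k : ℕ) := by exact_mod_cast le_max_right m k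
    linarith

lemma tendsto_setIntegral_Ioc_one_div {f : ℝ → ℂ} (hf : IntegrableOn f (Ioi 0)) :
    Filter.Tendsto (fun n : ℕ => ∫ x in Ioc (1 / ((n : ℝ) + 1)) ((n : ℝ) + 1), f x) Filter.atTop
      (nhds (∫ x in Ioi (0 : ℝ), f x)) := by
  have h := tendsto_setIntegral_of_monotone (μ := volume) (f := f)
    (s := fun n : ℕ => Ioc (1 / ((n : ℝ) + 1)) ((n : ℝ) + 1)) (fun _ => measurableSet_Ioc)
    (fun m n hmn => Ioc_subset_Ioc (Nat.one_div_le_one_div hmn)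
      (by have : (m : ℝ) ≤ n := by exact_mod_cast hmn
          linarith))
    (by rw [iUnion_Ioc_one_div]; exact hf)
  rwa [iUnion_Ioc_one_div] at h

/-- On the Widder side the order of integration can be exchanged for `x` in a compact interval. -/
lemma integral_widder_swap {ν : ℂ} (hν : ν.re = 0) {t a b : ℝ} (ht : 0 < t) (ha : 0 < a)
    {h : ℝ → ℂ} (hh : AEStronglyMeasurable h (volume.restrict (Ioi (0 : ℝ))))
    (hX : IntegrableOn (fun u => ‖h u‖ / (1 + u ^ 2)) (Ioi 0)) :
    ∫ x in Ioc a b, (x : ℂ) * (x : ℂ) ^ (2 * ν) * ((1 / (x ^ 2 + t ^ 2) : ℝ) : ℂ) *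
        ∫ u in Ioi (0 : ℝ), h u / ((u : ℂ) ^ 2 + (x : ℂ) ^ 2) =
      ∫ u in Ioi (0 : ℝ), (∫ x in Ioc a b, (x : ℂ) * (x : ℂ) ^ (2 * ν) *
        ((1 / (x ^ 2 + t ^ 2) : ℝ) : ℂ) * (1 / ((u : ℂ) ^ 2 + (x : ℂ) ^ 2))) * h u := by
  have e : ∀ u x : ℝ, h u / ((u : ℂ) ^ 2 + (x : ℂ) ^ 2) =
      (1 / ((u : ℂ) ^ 2 + (x : ℂ) ^ 2)) * h u := fun u x => by ring
  simp only [e, ← integral_const_mul, ← integral_mul_const, ← mul_assoc]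
  refine integral_integral_swap ?_
  have h1 : IntegrableOn (fun x : ℝ => x / t ^ 2 * (1 + 1 / a ^ 2)) (Ioc a b) :=
    ((continuous_id.div_const _).mul continuous_const).integrableOn_Ioc
  refine (h1.mul_prod hX).mono' ?_ ?_
  · unfold Function.uncurry
    exact AEStronglyMeasurable.mul (Measurable.aestronglyMeasurable (by fun_prop)) hh.comp_snd
  · have e1 := Measure.quasiMeasurePreserving_fst (μ := volume.restrict (Ioc a b))
      (ν := volume.restrict (Ioi (0 : ℝ)))
    filter_upwards [e1.ae (ae_restrict_mem measurableSet_Ioc)] with z hz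
    obtain ⟨x, u⟩ := z
    simp only [Function.uncurry] at hz ⊢
    have hx : 0 < x := ha.trans hz.1
    rw [norm_mul, norm_mul, norm_mul, norm_cpow_two_mul hx, hν, Complex.norm_real,
      Real.norm_of_nonneg (by positivity),
      show (1 / ((u : ℂ) ^ 2 + (x : ℂ) ^ 2)) = ((1 / (u ^ 2 + x ^ 2) : ℝ) : ℂ) by push_cast; rfl,
      Complex.norm_real, Real.norm_of_nonneg (by positivity), mul_zero, zero_add, Real.rpow_one]
    have h2 : 1 / (x ^ 2 + t ^ 2) ≤ 1 / t ^ 2 := by gcongr; nlinarith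
    have h3 : 1 / (u ^ 2 + x ^ 2) ≤ (1 + 1 / a ^ 2) * (1 / (1 + u ^ 2)) := by
      rw [mul_one_div, div_le_div_iff₀ (by positivity) (by positivity), one_mul]
      have : a ^ 2 ≤ x ^ 2 := by gcongr; exact hz.1.le
      exact one_add_sq_le (by positivity) (by nlinarith) (by nlinarith)
    calc _ ≤ x * (1 / t ^ 2) * ((1 + 1 / a ^ 2) * (1 / (1 + u ^ 2))) * ‖h u‖ := by gcongr
      _ = _ := by ring

theorem integral_eq_of_re_eq_zero {ν : ℂ} (hν : ν.re = 0) (hν0 : ν ≠ 0) {t : ℝ} (ht : 0 < t)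
    {h : ℝ → ℂ} (hh : AEStronglyMeasurable h (volume.restrict (Ioi (0 : ℝ))))
    (hX : ∀ x : ℝ, 0 < x → IntegrableOn (fun u => h u / ((u : ℂ) ^ 2 + (x : ℂ) ^ 2)) (Ioi 0))
    (hL : IntegrableOn (fun x : ℝ => (x : ℂ) * (x : ℂ) ^ (2 * ν) * ((1 / (x ^ 2 + t ^ 2) : ℝ) : ℂ) *
      ∫ u in Ioi (0 : ℝ), h u / ((u : ℂ) ^ 2 + (x : ℂ) ^ 2)) (Ioi 0)) :
    ∫ x in Ioi (0 : ℝ), (x : ℂ) * (x : ℂ) ^ (2 * ν) * ((1 / (x ^ 2 + t ^ 2) : ℝ) : ℂ) *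
        ∫ u in Ioi (0 : ℝ), h u / ((u : ℂ) ^ 2 + (x : ℂ) ^ 2) =
      ∫ y in Ioi (0 : ℝ), parsevalWeight ν y * heatIntegral 0 ν y t *
        ∫ u in Ioi (0 : ℝ), heatIntegral 0 ν y u * h u := by
  have hX1 := integrable_norm_div_one_add_sq hX
  refine tendsto_nhds_unique (tendsto_setIntegral_Ioc_one_div hL) ?_
  rw [integral_macdonald_swap hν hν0 ht hh hX1]
  have hswap := fun n : ℕ => integral_widder_swap (a := 1 / ((n : ℝ) + 1)) (b := (n : ℝ) + 1) hν ht
    (by positivity) hh hX1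
  simp only [hswap]
  refine tendsto_integral_of_dominated_convergence
    (fun u => 2 / ‖ν‖ * (1 + 1 / t ^ 2) * (‖h u‖ / (1 + u ^ 2)))
    (fun n => ?_) (hX1.const_mul _) (fun n => ?_) ?_
  · refine AEStronglyMeasurable.mul ?_ hh
    refine StronglyMeasurable.aestronglyMeasurable (StronglyMeasurable.integral_prod_right
      (f := fun u x : ℝ => (x : ℂ) * (x : ℂ) ^ (2 * ν) *
        ((1 / (x ^ 2 + t ^ 2) : ℝ) : ℂ) * (1 / ((u : ℂ) ^ 2 + (x : ℂ) ^ 2))) ?_)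
    refine Measurable.stronglyMeasurable ?_
    unfold Function.uncurry
    fun_prop
  · filter_upwards [ae_restrict_mem measurableSet_Ioi] with u hu
    have hu : 0 < u := hu
    have ha : 0 < 1 / ((n : ℝ) + 1) := by positivity
    have hab : 1 / ((n : ℝ) + 1) ≤ (n : ℝ) + 1 := by
      rw [div_le_iff₀ (by positivity)]
      nlinarith [Nat.cast_nonneg (α := ℝ) n]
    have e : ∫ x in Ioc (1 / ((n : ℝ) + 1)) ((n : ℝ) + 1), (x : ℂ) * (x : ℂ) ^ (2 * ν) *
        ((1 / (x ^ 2 + t ^ 2) : ℝ) : ℂ) * (1 / ((u : ℂ) ^ 2 + (x : ℂ) ^ 2)) =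
        ∫ x in (1 / ((n : ℝ) + 1))..((n : ℝ) + 1),
          (widderFactor t u x : ℂ) * (x : ℂ) ^ (2 * ν - 1) := by
      rw [intervalIntegral.integral_of_le hab]
      exact setIntegral_congr_fun measurableSet_Ioc fun x hx => widder_integrand_eq (ha.trans hx.1)
    rw [e, norm_mul]
    have b1 := norm_integral_widderFactor_le hν hν0 ht hu ha hab
    have b2 := norm_integral_widderFactor_le hν hν0 hu ht ha hab
    simp only [widderFactor_comm u t] at b2
    set Q := ‖∫ x in (1 / ((n : ℝ) + 1))..((n : ℝ) + 1),
          (widderFactor t u x : ℂ) * (x : ℂ) ^ (2 * ν - 1)‖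
    have b3 : Q ≤ 2 / ‖ν‖ * (1 + 1 / t ^ 2) / (1 + u ^ 2) := by
      rw [le_div_iff₀ (by positivity)]
      have : Q * u ^ 2 ≤ 2 / ‖ν‖ := by
        rwa [mul_one_div, le_div_iff₀ (by positivity)] at b1
      linarith
    calc _ ≤ 2 / ‖ν‖ * (1 + 1 / t ^ 2) / (1 + u ^ 2) * ‖h u‖ := by gcongr
      _ = _ := by ring
  · filter_upwards [ae_restrict_mem measurableSet_Ioi] with u hu
    rw [← integral_kernel_eq hν ht hu]
    exact (tendsto_setIntegral_Ioc_one_div (integrableOn_widder_kernel hν ht hu)).mul_const _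

/-! ### The transforms in terms of `heatIntegral` -/

lemma sqrt_mul_eq (ν : ℂ) (g : ℝ → ℂ) {u : ℝ} (hu : 0 < u) :
    (Real.sqrt u : ℂ) * g u = (u : ℂ) ^ ν * ((u : ℂ) * ((u : ℂ) ^ (-ν - 1 / 2) * g u)) := by
  have hu0 : (u : ℂ) ≠ 0 := by exact_mod_cast hu.ne'
  have e : (u : ℂ) ^ ν * ((u : ℂ) * (u : ℂ) ^ (-ν - 1 / 2)) = (Real.sqrt u : ℂ) := by
    rw [Real.sqrt_eq_rpow, Complex.ofReal_cpow hu.le]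
    nth_rewrite 2 [← Complex.cpow_one (u : ℂ)]
    rw [← Complex.cpow_add _ _ hu0, ← Complex.cpow_add _ _ hu0]
    congr 1
    push_cast
    ring
  rw [← e]
  ring

lemma macdonaldIntegrand_eq (ν : ℂ) (g : ℝ → ℂ) {y u : ℝ} (hy : 0 < y) (hu : 0 < u) :
    macdonaldIntegrand ν g y u = (Real.sqrt y : ℂ) * (1 / 2 * ((y / 2 : ℝ) : ℂ) ^ ν) *
      (heatIntegral 0 ν y u * ((u : ℂ) * ((u : ℂ) ^ (-ν - 1 / 2) * g u))) := by
  have h1 := cpow_mul_macdonaldK ν hy hu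
  have h2 := sqrt_mul_eq ν g hu
  unfold macdonaldIntegrand
  rw [Real.sqrt_mul hu.le]
  push_cast at h1 ⊢
  linear_combination ((Real.sqrt y : ℂ) * macdonaldK ν (u * y)) * h2 +
    ((Real.sqrt y : ℂ) * ((u : ℂ) * ((u : ℂ) ^ (-ν - 1 / 2) * g u))) * h1

lemma macdonaldTransform_eq (ν : ℂ) (g : ℝ → ℂ) {y : ℝ} (hy : 0 < y) :
    macdonaldTransform ν g y = (Real.sqrt y : ℂ) * (1 / 2 * ((y / 2 : ℝ) : ℂ) ^ ν) *
      ∫ u in Ioi (0 : ℝ), heatIntegral 0 ν y u * ((u : ℂ) * ((u : ℂ) ^ (-ν - 1 / 2) * g u)) := by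
  unfold macdonaldTransform
  rw [← integral_const_mul]
  exact setIntegral_congr_fun measurableSet_Ioi fun u hu => macdonaldIntegrand_eq ν g hy hu

lemma cpow_mul_macdonaldIntegrand_eq (ν : ℂ) (g : ℝ → ℂ) {t y : ℝ} (ht : 0 < t) (hy : 0 < y) :
    (t : ℂ) ^ (ν - 1 / 2) * macdonaldIntegrand ν (fun y => macdonaldTransform ν g y) t y =
      parsevalWeight ν y * heatIntegral 0 ν y t *
        ∫ u in Ioi (0 : ℝ), heatIntegral 0 ν y u *
          ((u : ℂ) * ((u : ℂ) ^ (-ν - 1 / 2) * g u)) := by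
  have ht0 : (t : ℂ) ≠ 0 := by exact_mod_cast ht.ne'
  have h1 := cpow_mul_macdonaldK ν hy ht
  have h2 : (t : ℂ) ^ (ν - 1 / 2) * (Real.sqrt t : ℂ) = (t : ℂ) ^ ν := by
    rw [Real.sqrt_eq_rpow, Complex.ofReal_cpow ht.le, ← Complex.cpow_add _ _ ht0]
    congr 1
    push_cast
    ring
  have h3 : (Real.sqrt y : ℂ) * (Real.sqrt y : ℂ) = y := by
    rw [← Complex.ofReal_mul, Real.mul_self_sqrt hy.le]
  simp only [macdonaldIntegrand]
  rw [macdonaldTransform_eq ν g hy, mul_comm y t, Real.sqrt_mul ht.le]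
  set Φ := ∫ u in Ioi (0 : ℝ), heatIntegral 0 ν y u * ((u : ℂ) * ((u : ℂ) ^ (-ν - 1 / 2) * g u))
  unfold parsevalWeight
  set W := ((y / 2 : ℝ) : ℂ) ^ ν
  rw [Complex.ofReal_mul]
  linear_combination (Real.sqrt y * macdonaldK ν (t * y) * (Real.sqrt y * (1 / 2 * W) * Φ)) * h2 +
    (Real.sqrt y * (Real.sqrt y * (1 / 2 * W) * Φ)) * h1 +
    ((1 / 2 * W) ^ 2 * heatIntegral 0 ν y t * Φ) * h3

lemma widderIntegrand_eq (ν : ℂ) (F : ℝ → ℂ) (t x : ℝ) :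
    widderIntegrand (fun x => (x : ℂ) ^ (2 * ν) * F x) t x =
      (x : ℂ) * (x : ℂ) ^ (2 * ν) * ((1 / (x ^ 2 + t ^ 2) : ℝ) : ℂ) * F x := by
  unfold widderIntegrand
  push_cast
  ring

/-- The identity for the `𝒦_ν`-transform. -/
theorem widderTransform_widderTransform {g : ℝ → ℂ} {t : ℝ} (ht : 0 < t) {ν : ℂ}
    (hν : -1 < ν.re)
    (hX : ∀ x : ℝ, 0 < x → WidderExists (fun u => (u : ℂ) ^ (-ν - 1 / 2) * g u) x)
    (hL : WidderExists (fun x => (x : ℂ) ^ (2 * ν) *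
      widderTransform (fun u => (u : ℂ) ^ (-ν - 1 / 2) * g u) x) t)
    (hK : ∀ y : ℝ, 0 < y → MacdonaldExists ν g y)
    (hR : MacdonaldExists ν (fun y => macdonaldTransform ν g y) t) :
    widderTransform (fun x => (x : ℂ) ^ (2 * ν) *
        widderTransform (fun u => (u : ℂ) ^ (-ν - 1 / 2) * g u) x) t =
      (t : ℂ) ^ (ν - 1 / 2) * macdonaldTransform ν (fun y => macdonaldTransform ν g y) t := by
  let h : ℝ → ℂ := fun u => (u : ℂ) * ((u : ℂ) ^ (-ν - 1 / 2) * g u)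
  have hX' : ∀ x : ℝ, 0 < x → IntegrableOn (fun u => h u / ((u : ℂ) ^ 2 + (x : ℂ) ^ 2)) (Ioi 0) := hX
  have hh : AEStronglyMeasurable h (volume.restrict (Ioi (0 : ℝ))) := by
    refine AEStronglyMeasurable.congr (f := fun u : ℝ => ((u : ℂ) ^ 2 + ((1 : ℝ) : ℂ) ^ 2) *
      (h u / ((u : ℂ) ^ 2 + ((1 : ℝ) : ℂ) ^ 2))) ?_ ?_
    · exact AEStronglyMeasurable.mul (by fun_prop) (hX' 1 one_pos).1
    · refine Filter.Eventually.of_forall fun u => mul_div_cancel₀ _ ?_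
      have : ((u ^ 2 + 1 ^ 2 : ℝ) : ℂ) ≠ 0 := by
        exact_mod_cast (by positivity : (0 : ℝ) < u ^ 2 + 1 ^ 2).ne'
      exact_mod_cast this
  have hL' : IntegrableOn (fun x : ℝ => (x : ℂ) * (x : ℂ) ^ (2 * ν) *
      ((1 / (x ^ 2 + t ^ 2) : ℝ) : ℂ) *
      ∫ u in Ioi (0 : ℝ), h u / ((u : ℂ) ^ 2 + (x : ℂ) ^ 2)) (Ioi 0) := by
    refine IntegrableOn.congr_fun hL (fun x _ => ?_) measurableSet_Ioi
    exact widderIntegrand_eq ν _ t x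
  have hK' : ∀ y : ℝ, 0 < y → IntegrableOn (fun u => heatIntegral 0 ν y u * h u) (Ioi 0) := by
    intro y hy
    have hc : (Real.sqrt y : ℂ) * (1 / 2 * ((y / 2 : ℝ) : ℂ) ^ ν) ≠ 0 := by
      have h1 : (Real.sqrt y : ℂ) ≠ 0 := by exact_mod_cast (Real.sqrt_pos.2 hy).ne'
      have h2 : ((y / 2 : ℝ) : ℂ) ≠ 0 := by exact_mod_cast (half_pos hy).ne'
      have h3 : ((y / 2 : ℝ) : ℂ) ^ ν ≠ 0 := fun h => h2 ((Complex.cpow_eq_zero_iff _ _).1 h).1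
      exact mul_ne_zero h1 (mul_ne_zero (by norm_num) h3)
    have h1 := (hK y hy).const_mul ((Real.sqrt y : ℂ) * (1 / 2 * ((y / 2 : ℝ) : ℂ) ^ ν))⁻¹
    refine IntegrableOn.congr_fun h1 (fun u hu => ?_) measurableSet_Ioi
    rw [macdonaldIntegrand_eq ν g hy hu, inv_mul_cancel_left₀ hc]
  have hR' : IntegrableOn (fun y : ℝ => parsevalWeight ν y * heatIntegral 0 ν y t *
      ∫ u in Ioi (0 : ℝ), heatIntegral 0 ν y u * h u) (Ioi 0) :=
    IntegrableOn.congr_fun (Integrable.const_mul hR _)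
      (fun y hy => cpow_mul_macdonaldIntegrand_eq ν g ht hy) measurableSet_Ioi
  have main : ∫ x in Ioi (0 : ℝ), (x : ℂ) * (x : ℂ) ^ (2 * ν) * ((1 / (x ^ 2 + t ^ 2) : ℝ) : ℂ) *
        ∫ u in Ioi (0 : ℝ), h u / ((u : ℂ) ^ 2 + (x : ℂ) ^ 2) =
      ∫ y in Ioi (0 : ℝ), parsevalWeight ν y * heatIntegral 0 ν y t *
        ∫ u in Ioi (0 : ℝ), heatIntegral 0 ν y u * h u := by
    by_cases hc : ν.re ≠ 0 ∨ ν = 0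
    · exact integral_eq_of_re_ne_zero hc hν ht hh hX' hK' hL' hR'
    · push Not at hc
      exact integral_eq_of_re_eq_zero hc.1 hc.2 ht hh hX' hL'
  have hleft : widderTransform (fun x => (x : ℂ) ^ (2 * ν) *
      widderTransform (fun u => (u : ℂ) ^ (-ν - 1 / 2) * g u) x) t =
      ∫ x in Ioi (0 : ℝ), (x : ℂ) * (x : ℂ) ^ (2 * ν) * ((1 / (x ^ 2 + t ^ 2) : ℝ) : ℂ) *
        ∫ u in Ioi (0 : ℝ), h u / ((u : ℂ) ^ 2 + (x : ℂ) ^ 2) :=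
    integral_congr_ae (Filter.Eventually.of_forall fun x => widderIntegrand_eq ν _ t x)
  rw [hleft, main]
  conv_rhs => unfold macdonaldTransform
  rw [← integral_const_mul]
  exact (setIntegral_congr_fun measurableSet_Ioi
    fun y hy => cpow_mul_macdonaldIntegrand_eq ν g ht hy).symm

/-! ### The orders `±1/2` and the Laplace transform -/

lemma image_sinh_half_Ioi : (fun s : ℝ => Real.sinh (s / 2)) '' Ioi 0 = Ioi 0 := by
  ext v
  simp only [mem_image, mem_Ioi]
  constructor
  · rintro ⟨s, hs, rfl⟩
    exact Real.sinh_pos_iff.2 (by positivity)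
  · intro hv
    refine ⟨2 * Real.arsinh v, by have := Real.arsinh_pos_iff.2 hv; positivity, ?_⟩
    rw [mul_div_cancel_left₀ _ two_ne_zero, Real.sinh_arsinh]

/-- The substitution `v = sinh (s / 2)` turns the integral for `K_{1/2}` into a Gaussian one. -/
lemma macdonaldK_half (z : ℝ) :
    macdonaldK (1 / 2) z = ((Real.sqrt (Real.pi / (2 * z)) * Real.exp (-z) : ℝ) : ℂ) := by
  have hd : ∀ s ∈ Ioi (0 : ℝ), HasDerivWithinAt (fun s : ℝ => Real.sinh (s / 2))
      (Real.cosh (s / 2) * (1 / 2)) (Ioi 0) s := fun s _ =>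
    ((hasDerivAt_id s).div_const 2).sinh.hasDerivWithinAt
  have hinj : InjOn (fun s : ℝ => Real.sinh (s / 2)) (Ioi 0) := fun a _ b _ hab => by
    have := Real.sinh_injective hab
    linarith
  have hsub := integral_image_eq_integral_abs_deriv_smul measurableSet_Ioi hd hinj
    (fun v => 2 * Real.exp (-z) * Real.exp (-(2 * z) * v ^ 2))
  rw [image_sinh_half_Ioi, integral_const_mul, integral_gaussian_Ioi] at hsub
  have e : ∫ s in Ioi (0 : ℝ), |Real.cosh (s / 2) * (1 / 2)| •
      (2 * Real.exp (-z) * Real.exp (-(2 * z) * Real.sinh (s / 2) ^ 2)) =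
      ∫ s in Ioi (0 : ℝ), Real.exp (-z * Real.cosh s) * Real.cosh (s / 2) := by
    refine integral_congr_ae (Filter.Eventually.of_forall fun s => ?_)
    have h1 : Real.cosh s = 1 + 2 * Real.sinh (s / 2) ^ 2 := by
      have h2 := Real.cosh_two_mul (s / 2)
      rw [mul_div_cancel₀ s two_ne_zero, Real.cosh_sq] at h2
      linarith
    have h3 := Real.cosh_pos (s / 2)
    simp only [smul_eq_mul]
    rw [abs_of_pos (by positivity), h1, show -z * (1 + 2 * Real.sinh (s / 2) ^ 2) =
      -z + -(2 * z) * Real.sinh (s / 2) ^ 2 by ring, Real.exp_add]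
    ring
  rw [e] at hsub
  rw [show Real.sqrt (Real.pi / (2 * z)) * Real.exp (-z) =
    2 * Real.exp (-z) * (Real.sqrt (Real.pi / (2 * z)) / 2) by ring, hsub,
    ← integral_complex_ofReal]
  unfold macdonaldK
  refine integral_congr_ae (Filter.Eventually.of_forall fun s => ?_)
  simp only
  rw [Complex.ofReal_mul, Complex.ofReal_cosh]
  congr 2
  push_cast
  ring

lemma macdonaldIntegrand_eq_laplace {ν : ℂ}
    (hν : ∀ z, macdonaldK ν z = macdonaldK (1 / 2) z) (f : ℝ → ℂ) {y x : ℝ} (hy : 0 < y)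
    (hx : 0 < x) :
    macdonaldIntegrand ν f y x = (Real.sqrt (Real.pi / 2) : ℂ) * laplaceIntegrand f y x := by
  unfold macdonaldIntegrand laplaceIntegrand
  have hxy : 0 < x * y := mul_pos hx hy
  rw [hν, macdonaldK_half (x * y), ← Complex.ofReal_mul, ← mul_assoc (Real.sqrt (x * y)),
    ← Real.sqrt_mul hxy.le, show x * y * (Real.pi / (2 * (x * y))) = Real.pi / 2 by field_simp,
    Complex.ofReal_mul, mul_assoc]

lemma sqrt_pi_div_two_mul_self :
    (Real.sqrt (Real.pi / 2) : ℂ) * (Real.sqrt (Real.pi / 2) : ℂ) = (Real.pi / 2 : ℂ) := by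
  rw [← Complex.ofReal_mul, Real.mul_self_sqrt (by positivity)]
  push_cast
  rfl

lemma macdonaldIntegrand_macdonaldTransform {ν : ℂ}
    (hν : ∀ z, macdonaldK ν z = macdonaldK (1 / 2) z) (g : ℝ → ℂ) {t y : ℝ} (ht : 0 < t)
    (hy : 0 < y) :
    macdonaldIntegrand ν (fun y => macdonaldTransform ν g y) t y =
      (Real.pi / 2 : ℂ) * laplaceIntegrand (fun y => laplaceTransform g y) t y := by
  have e : macdonaldTransform ν g y = (Real.sqrt (Real.pi / 2) : ℂ) * laplaceTransform g y := by
    unfold macdonaldTransform laplaceTransform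
    rw [← integral_const_mul]
    exact setIntegral_congr_fun measurableSet_Ioi fun u hu =>
      macdonaldIntegrand_eq_laplace hν g hy hu
  rw [macdonaldIntegrand_eq_laplace hν _ ht hy]
  simp only [laplaceIntegrand]
  rw [e, ← sqrt_pi_div_two_mul_self]
  ring

lemma macdonaldExists_of_laplaceExists {ν : ℂ}
    (hν : ∀ z, macdonaldK ν z = macdonaldK (1 / 2) z) {g : ℝ → ℂ} {y : ℝ} (hy : 0 < y)
    (h : LaplaceExists g y) : MacdonaldExists ν g y :=
  IntegrableOn.congr_fun (Integrable.const_mul h _)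
    (fun _ hu => (macdonaldIntegrand_eq_laplace hν g hy hu).symm) measurableSet_Ioi

lemma macdonaldExists_macdonaldTransform {ν : ℂ}
    (hν : ∀ z, macdonaldK ν z = macdonaldK (1 / 2) z) {g : ℝ → ℂ} {t : ℝ} (ht : 0 < t)
    (h : LaplaceExists (fun y => laplaceTransform g y) t) :
    MacdonaldExists ν (fun y => macdonaldTransform ν g y) t :=
  IntegrableOn.congr_fun (Integrable.const_mul h _)
    (fun _ hy => (macdonaldIntegrand_macdonaldTransform hν g ht hy).symm) measurableSet_Ioi

lemma macdonaldTransform_macdonaldTransform {ν : ℂ}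
    (hν : ∀ z, macdonaldK ν z = macdonaldK (1 / 2) z) (g : ℝ → ℂ) {t : ℝ} (ht : 0 < t) :
    macdonaldTransform ν (fun y => macdonaldTransform ν g y) t =
      (Real.pi / 2 : ℂ) * laplaceTransform (fun y => laplaceTransform g y) t := by
  conv_lhs => unfold macdonaldTransform
  conv_rhs => unfold laplaceTransform
  rw [← integral_const_mul]
  exact setIntegral_congr_fun measurableSet_Ioi fun y hy =>
    macdonaldIntegrand_macdonaldTransform hν g ht hy

end

theorem mainTheorem6 (g : ℝ → ℂ) (t : ℝ) (ht : 0 < t) :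
    (∀ ν : ℂ, -1 < ν.re → ν.re < 3 / 2 →
      (∀ x : ℝ, 0 < x → WidderExists (fun u => (u : ℂ) ^ (-ν - 1 / 2) * g u) x) →
      WidderExists
        (fun x => (x : ℂ) ^ (2 * ν) *
          widderTransform (fun u => (u : ℂ) ^ (-ν - 1 / 2) * g u) x) t →
      (∀ y : ℝ, 0 < y → MacdonaldExists ν g y) →
      MacdonaldExists ν (fun y => macdonaldTransform ν g y) t →
      widderTransform
          (fun x => (x : ℂ) ^ (2 * ν) *
            widderTransform (fun u => (u : ℂ) ^ (-ν - 1 / 2) * g u) x) t =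
        (t : ℂ) ^ (ν - 1 / 2) *
          macdonaldTransform ν (fun y => macdonaldTransform ν g y) t) ∧
    ((∀ x : ℝ, 0 < x → WidderExists (fun u => (u : ℂ)⁻¹ * g u) x) →
      WidderExists (fun x => (x : ℂ) * widderTransform (fun u => (u : ℂ)⁻¹ * g u) x) t →
      (∀ y : ℝ, 0 < y → LaplaceExists g y) →
      LaplaceExists (fun y => laplaceTransform g y) t →
      widderTransform (fun x => (x : ℂ) * widderTransform (fun u => (u : ℂ)⁻¹ * g u) x) t =
        (Real.pi / 2 : ℂ) * laplaceTransform (fun y => laplaceTransform g y) t) ∧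
    ((∀ x : ℝ, 0 < x → WidderExists g x) →
      WidderExists (fun x => (x : ℂ)⁻¹ * widderTransform g x) t →
      (∀ y : ℝ, 0 < y → LaplaceExists g y) →
      LaplaceExists (fun y => laplaceTransform g y) t →
      widderTransform (fun x => (x : ℂ)⁻¹ * widderTransform g x) t =
        (Real.pi / 2 : ℂ) * (t : ℂ)⁻¹ *
          laplaceTransform (fun y => laplaceTransform g y) t) := by
  
  refine ⟨fun ν hν _ hX hL hK hR => widderTransform_widderTransform ht hν hX hL hK hR, ?_, ?_⟩
  · intro hX hL hK hR
    have hν : ∀ z, macdonaldK (1 / 2 : ℂ) z = macdonaldK (1 / 2) z := fun _ => rfl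
    have e1 : ∀ u : ℝ, (u : ℂ) ^ (-(1 / 2 : ℂ) - 1 / 2) = (u : ℂ)⁻¹ := fun u => by
      rw [show -(1 / 2 : ℂ) - 1 / 2 = -1 by norm_num, Complex.cpow_neg_one]
    have e2 : ∀ x : ℝ, (x : ℂ) ^ (2 * (1 / 2 : ℂ)) = x := fun x => by
      rw [show 2 * (1 / 2 : ℂ) = 1 by norm_num, Complex.cpow_one]
    have h := widderTransform_widderTransform (g := g) ht (ν := 1 / 2) (by norm_num)
      (by simpa only [e1] using hX) (by simpa only [e1, e2] using hL)
      (fun y hy => macdonaldExists_of_laplaceExists hν hy (hK y hy))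
      (macdonaldExists_macdonaldTransform hν ht hR)
    simp only [e1, e2] at h
    rw [h, macdonaldTransform_macdonaldTransform hν g ht, sub_self, Complex.cpow_zero, one_mul]
  · intro hX hL hK hR
    have hν : ∀ z, macdonaldK (-(1 / 2) : ℂ) z = macdonaldK (1 / 2) z := macdonaldK_neg _
    have e1 : ∀ u : ℝ, (u : ℂ) ^ (-(-(1 / 2) : ℂ) - 1 / 2) = 1 := fun u => by
      rw [show -(-(1 / 2) : ℂ) - 1 / 2 = 0 by norm_num, Complex.cpow_zero]
    have e2 : ∀ x : ℝ, (x : ℂ) ^ (2 * (-(1 / 2) : ℂ)) = (x : ℂ)⁻¹ := fun x => by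
      rw [show 2 * (-(1 / 2) : ℂ) = -1 by norm_num, Complex.cpow_neg_one]
    have h := widderTransform_widderTransform (g := g) ht (ν := -(1 / 2)) (by norm_num)
      (by simpa only [e1, one_mul] using hX) (by simpa only [e1, e2, one_mul] using hL)
      (fun y hy => macdonaldExists_of_laplaceExists hν hy (hK y hy))
      (macdonaldExists_macdonaldTransform hν ht hR)
    simp only [e1, e2, one_mul] at h
    rw [h, macdonaldTransform_macdonaldTransform hν g ht,
      show (-(1 / 2) : ℂ) - 1 / 2 = -1 by norm_num, Complex.cpow_neg_one]
    ring
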